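/- Let $d\ge 1$ and $\tau>d/2$, and let $k(x,z)=\Phi(x-z)$ be a translation invariant kernel on $\mathbb R^d$ with $\Phi:\mathbb R^d\to\mathbb R$ continuous and integrable. Assume that its Fourier transform $\hat\Phi(\omega)=(2\pi)^{-d/2}\int_{\mathbb R^d}\Phi(x)e^{-i\omega^\top x}\,dx$ is real-valued and satisfies $$c_\Phi(1+\|\omega\|^2)^{-\tau}\le\hat\Phi(\omega)\le C_\Phi(1+\|\omega\|^2)^{-\tau}\qquad\text{for all }\omega\in\mathbb R^d$$ with constants $c_\Phi,C_\Phi>0$, where $\|\cdot\|$ is the Euclidean norm. Let $\lambda_{\min}(-\Delta)$ be the smallest eigenvalue of the Dirichlet Laplace operator on the ball $B_{1/2}(0)\subset\mathbb R^d$, and put $$c_0=\sqrt2\,\lambda_{\min}(-\Delta)^{1/2},\qquad c_1=\frac{\pi^{d/2}}{2\,\lambda_{\min}(-\Delta)^{d/2}}.$$ For a finite set $X\subset\mathbb R^d$ with at least two points, let $q_X=\min_{x\ne y\in X}\|x-y\|$ and let $k(X,X)=(k(x,y))_{x,y\in X}$ be the kernel matrix. Then, for every such $X$, $$\lambda_{\min}(k(X,X))\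 \ge\ \frac{c_0^d\,c_1\,c_\Phi}{(2\pi)^{d/2}}\,(q_X^2+c_0^2)^{-\tau}\,q_X^{2\tau-d}.$$ Moreover, for every bounded $\Omega\subset\mathbb R^d$ there is a constant $c>0$ (depending only on $\tau,d,\Omega,\Phi$) such that $\lambda_{\min}(k(X,X))\ge c\,q_X^{2\tau-d}$ for every finite $X\subset\Omega$ with at least two points. -/

import Mathlib

open MeasureTheory Filter Topology
open scoped ContDiff ENNReal

noncomputable section

/-- Real-valued test functions `C_c^∞(U)`, extended by zero to the whole space. -/
structure IsTestFunction {d : ℕ} (U : Set (EuclideanSpace ℝ (Fin d)))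
    (v : EuclideanSpace ℝ (Fin d) → ℝ) : Prop where
  smooth : ContDiff ℝ ∞ v
  compact_support : HasCompactSupport v
  support_subset : tsupport v ⊆ U

/-- `u` (extended by zero) belongs to the Sobolev space `H₀¹(U)`, the `H¹`-closure of `C_c^∞(U)`,
and `G` is its weak gradient: `(u, G)` is the limit in `L² × L²` of pairs `(φ, ∇φ)` with test
functions `φ`. -/
structure IsH10 {d : ℕ} (U : Set (EuclideanSpace ℝ (Fin d)))
    (u : EuclideanSpace ℝ (Fin d) → ℝ)
    (G : EuclideanSpace ℝ (Fin d) → EuclideanSpace ℝ (Fin d)) : Prop where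
  memLp : MemLp u 2 volume
  memLp_grad : MemLp G 2 volume
  approx : ∃ φ : ℕ → EuclideanSpace ℝ (Fin d) → ℝ,
    (∀ n, IsTestFunction U (φ n)) ∧
    Tendsto (fun n => eLpNorm (fun x => φ n x - u x) 2 volume) atTop (𝓝 0) ∧
    Tendsto (fun n => eLpNorm (fun x => gradient (φ n) x - G x) 2 volume) atTop (𝓝 0)

/-- `lam` is an eigenvalue of the Dirichlet Laplace operator `-Δ` on the open set `U`: there is
`0 ≠ u ∈ H₀¹(U)` with `-Δ u = lam • u` weakly in `U`. -/
def IsDirichletEigenvalue {d : ℕ} (U : Set (EuclideanSpace ℝ (Fin d))) (lam : ℝ) : Prop :=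
  ∃ (u : EuclideanSpace ℝ (Fin d) → ℝ)
    (G : EuclideanSpace ℝ (Fin d) → EuclideanSpace ℝ (Fin d)),
    IsH10 U u G ∧ ¬ (u =ᵐ[volume] 0) ∧
    ∀ v : EuclideanSpace ℝ (Fin d) → ℝ, IsTestFunction U v →
      ∫ x, inner ℝ (G x) (gradient v x) = lam * ∫ x, u x * v x

/-- The smallest eigenvalue of the Dirichlet Laplace operator on the ball `B_{1/2}(0) ⊂ ℝ^d`. -/
def dirichletLambdaMin (d : ℕ) : ℝ :=
  sInf {lam : ℝ |
    IsDirichletEigenvalue (Metric.ball (0 : EuclideanSpace ℝ (Fin d)) (1 / 2)) lam}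

/-- The constant `c₀ = √2 · λ_min(-Δ)^{1/2}`. -/
def c0 (d : ℕ) : ℝ := Real.sqrt 2 * Real.sqrt (dirichletLambdaMin d)

/-- The constant `c₁ = π^{d/2} / (2 λ_min(-Δ)^{d/2})`. -/
def c1 (d : ℕ) : ℝ :=
  Real.pi ^ ((d : ℝ) / 2) / (2 * dirichletLambdaMin d ^ ((d : ℝ) / 2))

/-- The Fourier transform in the unitary normalization,
`Φ̂(ω) = (2π)^{-d/2} ∫ Φ(x) e^{-i ωᵀx} dx`. -/
def fourierSymbol {d : ℕ} (Φ : EuclideanSpace ℝ (Fin d) → ℝ)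
    (w : EuclideanSpace ℝ (Fin d)) : ℂ :=
  (((2 * Real.pi) ^ (-((d : ℝ) / 2)) : ℝ) : ℂ) *
    ∫ x, (Φ x : ℂ) * Complex.exp (-(Complex.I * ((inner ℝ w x : ℝ) : ℂ)))

/-- `Φ̂` is real-valued with
`cΦ (1 + ‖ω‖²)^{-τ} ≤ Φ̂(ω) ≤ CΦ (1 + ‖ω‖²)^{-τ}` for all `ω`. -/
def FourierDecay {d : ℕ} (Φ : EuclideanSpace ℝ (Fin d) → ℝ) (cΦ CΦ τ : ℝ) : Prop :=
  ∀ w : EuclideanSpace ℝ (Fin d), ∃ s : ℝ, fourierSymbol Φ w = (s : ℂ) ∧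
    cΦ * (1 + ‖w‖ ^ 2) ^ (-τ) ≤ s ∧ s ≤ CΦ * (1 + ‖w‖ ^ 2) ^ (-τ)

/-- The kernel matrix `k(X, X)`. -/
def kernelMatrix {E : Type*} (k : E → E → ℝ) (X : Finset E) : Matrix X X ℝ :=
  Matrix.of fun x z => k (x : E) (z : E)

/-- `lam` is the smallest (real) eigenvalue of the matrix `A`. -/
def IsMinEigenvalue {ι : Type*} [Fintype ι] [DecidableEq ι] (A : Matrix ι ι ℝ) (lam : ℝ) : Prop :=
  IsLeast {t : ℝ | Module.End.HasEigenvalue (Matrix.toLin' A) t} lam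

/-- The separation distance `q_X = min {‖x - y‖ : x ≠ y ∈ X}`. -/
def sepDist {d : ℕ} (X : Finset (EuclideanSpace ℝ (Fin d))) : ℝ :=
  (X : Set (EuclideanSpace ℝ (Fin d))).infsep

end

noncomputable section

open scoped FourierTransform SchwartzMap LineDeriv

/-! ### Gradients and test functions -/

section Gradient

variable {d : ℕ}

/-! By Fourier inversion the quadratic form of the kernel matrix is `∫ g ‖trigSum p α‖²`, where `g`
is the Fourier transform of `Φ` (`sum_kernel_eq_integral`). It is bounded below by replacing `g`
with a smaller symbol whose integral can be computed in physical space.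

Take a test function `u` on the ball of radius 1/2, rescale it to `v = u(·/q)` on the ball of radius
`q/2`, and put `w = ∑ α i v(· - p i)`. The Fourier transform of `w` is `trigSum p α` times that of
`v`. With `M = m/q²`, the function `A (M - ‖2πξ‖²) |𝓕 v(ξ)|²` lies below `g` for a suitable `A`: it
is nonpositive at high frequencies, and at low frequencies `𝓕 v` is bounded by Cauchy-Schwarz
(`symbol_minorant`). Plancherel turns its integral against `‖trigSum p α‖²` into `A (M ‖w‖² -
‖∇w‖²)`. The translates of `v` have disjoint supports, so both norms are `∑ α i ^ 2` times those of
`v`. What remains is the factor `1 - ‖∇u‖²/(m‖u‖²)` in `quadraticForm_lower_bound`, positive once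
the Rayleigh quotient of `u` is below `m = c₀² = 2 λ_min(-Δ)`.

It remains to find such `u` and to show `λ_min(-Δ) > 0`. Every Dirichlet eigenvalue is a limit of
Rayleigh quotients of test functions (`IsDirichletEigenvalue.exists_rayleigh_lt`); a Poincaré
inequality bounds these away from zero, and Rellich compactness shows that an eigenvalue exists.
Both are proved on the Fourier side. -/

theorem gradient_apply_eq_fderiv_single (f : EuclideanSpace ℝ (Fin d) → ℝ)
    (x : EuclideanSpace ℝ (Fin d)) (i : Fin d) :
    gradient f x i = fderiv ℝ f x (EuclideanSpace.single i 1) := by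
  rw [gradient, ← InnerProductSpace.toDual_symm_apply, EuclideanSpace.inner_single_right]
  simp

theorem norm_gradient_sq_eq_sum (f : EuclideanSpace ℝ (Fin d) → ℝ)
    (x : EuclideanSpace ℝ (Fin d)) :
    ‖gradient f x‖ ^ 2 = ∑ i, (fderiv ℝ f x (EuclideanSpace.single i 1)) ^ 2 := by
  rw [EuclideanSpace.real_norm_sq_eq]
  simp [gradient_apply_eq_fderiv_single]

theorem continuous_gradient {f : EuclideanSpace ℝ (Fin d) → ℝ} (hf : ContDiff ℝ ∞ f) :
    Continuous (gradient f) :=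
  (InnerProductSpace.toDual ℝ _).symm.continuous.comp (hf.continuous_fderiv (by simp))

theorem support_gradient_subset_tsupport (f : EuclideanSpace ℝ (Fin d) → ℝ) :
    Function.support (gradient f) ⊆ tsupport f := by
  intro x hx
  by_contra h
  refine hx ?_
  have : fderiv ℝ f x = 0 := by
    by_contra h'
    exact h (support_fderiv_subset ℝ h')
  simp [gradient, this]

theorem hasCompactSupport_gradient {f : EuclideanSpace ℝ (Fin d) → ℝ}
    (hf : HasCompactSupport f) : HasCompactSupport (gradient f) :=
  hf.mono' (support_gradient_subset_tsupport f)

theorem IsTestFunction.memLp {U : Set (EuclideanSpace ℝ (Fin d))}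
    {v : EuclideanSpace ℝ (Fin d) → ℝ} (hv : IsTestFunction U v) (p : ℝ≥0∞) :
    MemLp v p volume :=
  hv.smooth.continuous.memLp_of_hasCompactSupport hv.compact_support

theorem IsTestFunction.memLp_gradient {U : Set (EuclideanSpace ℝ (Fin d))}
    {v : EuclideanSpace ℝ (Fin d) → ℝ} (hv : IsTestFunction U v) (p : ℝ≥0∞) :
    MemLp (gradient v) p volume :=
  (continuous_gradient hv.smooth).memLp_of_hasCompactSupport
    (hasCompactSupport_gradient hv.compact_support)

theorem IsTestFunction.integrable_sq {U : Set (EuclideanSpace ℝ (Fin d))}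
    {v : EuclideanSpace ℝ (Fin d) → ℝ} (hv : IsTestFunction U v) :
    Integrable fun x => v x ^ 2 :=
  (hv.memLp 2).integrable_sq

theorem IsTestFunction.integrable_norm_gradient_sq {U : Set (EuclideanSpace ℝ (Fin d))}
    {v : EuclideanSpace ℝ (Fin d) → ℝ} (hv : IsTestFunction U v) :
    Integrable fun x => ‖gradient v x‖ ^ 2 :=
  (hv.memLp_gradient 2).norm.integrable_sq

end Gradient

/-! ### Plancherel identities for test functions -/

section Plancherel

variable {d : ℕ} {U : Set (EuclideanSpace ℝ (Fin d))} {w : EuclideanSpace ℝ (Fin d) → ℝ}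

/-- A real test function as a complex Schwartz function. -/
def IsTestFunction.toSchwartz (hw : IsTestFunction U w) : 𝓢(EuclideanSpace ℝ (Fin d), ℂ) :=
  HasCompactSupport.toSchwartzMap (f := fun x => (w x : ℂ))
    (hw.compact_support.comp_left (g := fun t : ℝ => (t : ℂ)) Complex.ofReal_zero)
    (Complex.ofRealCLM.contDiff.comp hw.smooth)

theorem IsTestFunction.coe_toSchwartz (hw : IsTestFunction U w) :
    ⇑hw.toSchwartz = fun x => (w x : ℂ) := rfl

theorem SchwartzMap.integrable_norm_sq (f : 𝓢(EuclideanSpace ℝ (Fin d), ℂ)) :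
    Integrable fun x => ‖f x‖ ^ 2 :=
  (f.memLp 2).norm.integrable_sq

theorem IsTestFunction.integrable_norm_fourier_sq (hw : IsTestFunction U w) :
    Integrable fun ξ => ‖𝓕 (fun x => (w x : ℂ)) ξ‖ ^ 2 :=
  SchwartzMap.integrable_norm_sq (𝓕 hw.toSchwartz)

theorem IsTestFunction.integral_norm_fourier_sq (hw : IsTestFunction U w) :
    ∫ ξ, ‖𝓕 (fun x => (w x : ℂ)) ξ‖ ^ 2 = ∫ x, w x ^ 2 := by
  have h := SchwartzMap.integral_norm_sq_fourier hw.toSchwartz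
  simpa [SchwartzMap.fourier_coe, hw.coe_toSchwartz] using h

theorem IsTestFunction.norm_fourier_lineDeriv_sq (hw : IsTestFunction U w) (i : Fin d)
    (ξ : EuclideanSpace ℝ (Fin d)) :
    ‖𝓕 (∂_{(EuclideanSpace.single i 1 : EuclideanSpace ℝ (Fin d))} hw.toSchwartz) ξ‖ ^ 2 =
      (2 * Real.pi) ^ 2 * ξ i ^ 2 * ‖𝓕 (fun x => (w x : ℂ)) ξ‖ ^ 2 := by
  rw [SchwartzMap.fourier_lineDerivOp_eq, smul_apply,
    SchwartzMap.smulLeftCLM_apply_apply (by fun_prop), SchwartzMap.fourier_coe, hw.coe_toSchwartz,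
    EuclideanSpace.inner_single_right]
  simp only [norm_smul, norm_mul, mul_pow]
  simp [abs_of_pos Real.pi_pos]
  ring

theorem IsTestFunction.norm_lineDeriv_sq (hw : IsTestFunction U w) (m x) :
    ‖(∂_{m} hw.toSchwartz) x‖ ^ 2 = fderiv ℝ w x m ^ 2 := by
  rw [SchwartzMap.lineDerivOp_apply_eq_fderiv, hw.coe_toSchwartz]
  have h : HasFDerivAt (fun x => (w x : ℂ)) (Complex.ofRealCLM.comp (fderiv ℝ w x)) x :=
    Complex.ofRealCLM.hasFDerivAt.comp x
      ((hw.smooth.differentiable (by simp)).differentiableAt.hasFDerivAt)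
  rw [h.fderiv]
  simp

/-- Splitting into coordinates lets scalar Plancherel be applied to each partial derivative, which
is again a complex Schwartz function. -/
theorem IsTestFunction.sq_mul_norm_fourier_sq_eq_sum (hw : IsTestFunction U w)
    (ξ : EuclideanSpace ℝ (Fin d)) :
    (2 * Real.pi * ‖ξ‖) ^ 2 * ‖𝓕 (fun x => (w x : ℂ)) ξ‖ ^ 2 =
      ∑ i, ‖𝓕 (∂_{(EuclideanSpace.single i 1 : EuclideanSpace ℝ (Fin d))} hw.toSchwartz) ξ‖ ^ 2 := by
  simp_rw [hw.norm_fourier_lineDeriv_sq, mul_pow _ ‖ξ‖, EuclideanSpace.real_norm_sq_eq,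
    Finset.mul_sum, Finset.sum_mul]

theorem IsTestFunction.integrable_sq_mul_norm_fourier_sq (hw : IsTestFunction U w) :
    Integrable fun ξ => (2 * Real.pi * ‖ξ‖) ^ 2 * ‖𝓕 (fun x => (w x : ℂ)) ξ‖ ^ 2 := by
  simp_rw [hw.sq_mul_norm_fourier_sq_eq_sum]
  exact integrable_finsetSum _ fun i _ => SchwartzMap.integrable_norm_sq _

theorem IsTestFunction.integral_sq_mul_norm_fourier_sq (hw : IsTestFunction U w) :
    ∫ ξ, (2 * Real.pi * ‖ξ‖) ^ 2 * ‖𝓕 (fun x => (w x : ℂ)) ξ‖ ^ 2 =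
      ∫ x, ‖gradient w x‖ ^ 2 := by
  simp_rw [hw.sq_mul_norm_fourier_sq_eq_sum, norm_gradient_sq_eq_sum, ← hw.norm_lineDeriv_sq]
  rw [integral_finsetSum _ fun i _ => SchwartzMap.integrable_norm_sq _,
    integral_finsetSum _ fun i _ => SchwartzMap.integrable_norm_sq _]
  exact Finset.sum_congr rfl fun i _ => SchwartzMap.integral_norm_sq_fourier _

end Plancherel

/-! ### Fourier representation of the kernel -/

section Kernel

variable {d : ℕ}

/-- Passes from the unitary transform in angular frequency to the kernel `e^{-2πi⟨x, ξ⟩}`; this is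
the source of every later `2π‖ξ‖`. -/
theorem fourier_eq_fourierSymbol (Φ : EuclideanSpace ℝ (Fin d) → ℝ) (ξ : EuclideanSpace ℝ (Fin d)) :
    𝓕 (fun x => (Φ x : ℂ)) ξ =
      (((2 * Real.pi) ^ ((d : ℝ) / 2) : ℝ) : ℂ) * fourierSymbol Φ ((2 * Real.pi) • ξ) := by
  rw [fourierSymbol, ← mul_assoc, ← Complex.ofReal_mul, ← Real.rpow_add (by positivity),
    add_neg_cancel, Real.rpow_zero, Complex.ofReal_one, one_mul, Real.fourier_eq']
  refine integral_congr_ae (Eventually.of_forall fun x => ?_)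
  simp only [smul_eq_mul, inner_smul_left, real_inner_comm x ξ]
  rw [mul_comm]
  congr 2
  push_cast
  simp
  ring

theorem integrable_one_add_norm_sq_rpow {τ : ℝ} (hτ : (d : ℝ) / 2 < τ) :
    Integrable fun x : EuclideanSpace ℝ (Fin d) => (1 + ‖x‖ ^ 2) ^ (-τ) := by
  have h := integrable_rpow_neg_one_add_norm_sq (E := EuclideanSpace ℝ (Fin d)) (μ := volume)
    (r := 2 * τ) (by simp; linarith)
  simpa [neg_div] using h

variable {Φ : EuclideanSpace ℝ (Fin d) → ℝ} {cΦ CΦ τ : ℝ}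

/-- The Fourier transform of `Φ`, in Mathlib's normalization, as a real integrable function with
its lower bound. -/
theorem FourierDecay.exists_real_fourier (hτ : (d : ℝ) / 2 < τ) (hcΦ : 0 < cΦ)
    (hint : Integrable Φ) (h : FourierDecay Φ cΦ CΦ τ) :
    ∃ g : EuclideanSpace ℝ (Fin d) → ℝ, Integrable g ∧
      (∀ ξ, 𝓕 (fun x => (Φ x : ℂ)) ξ = (g ξ : ℂ)) ∧
      ∀ ξ, (2 * Real.pi) ^ ((d : ℝ) / 2) * cΦ * (1 + (2 * Real.pi * ‖ξ‖) ^ 2) ^ (-τ) ≤ g ξ := by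
  choose s hs hl hu using h
  refine ⟨fun ξ => (2 * Real.pi) ^ ((d : ℝ) / 2) * s ((2 * Real.pi) • ξ), ?_, ?_, ?_⟩
  · refine Integrable.const_mul ?_ _
    have hmeas : Continuous (𝓕 (fun x => (Φ x : ℂ))) :=
      VectorFourier.fourierIntegral_continuous Real.continuous_fourierChar
        (by exact continuous_inner) hint.ofReal
    refine Integrable.comp_smul (R := 2 * Real.pi) ?_ (by positivity)
    -- The chosen `s` carries no regularity of its own; it inherits continuity, hence measurability,
    -- from the Fourier transform of `Φ`.
    have hsc : Continuous s := by
      have h2 : s = fun w => ((2 * Real.pi) ^ ((d : ℝ) / 2))⁻¹ *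
          (𝓕 (fun x => (Φ x : ℂ)) ((2 * Real.pi)⁻¹ • w)).re := by
        funext w
        rw [fourier_eq_fourierSymbol, smul_smul, mul_inv_cancel₀ (by positivity), one_smul, hs,
          ← Complex.ofReal_mul, Complex.ofReal_re, inv_mul_cancel_left₀ (by positivity)]
      rw [h2]
      exact continuous_const.mul (Complex.continuous_re.comp (hmeas.comp (by fun_prop)))
    refine ((integrable_one_add_norm_sq_rpow hτ).const_mul CΦ).mono'
      hsc.aestronglyMeasurable (Eventually.of_forall fun w => ?_)
    rw [Real.norm_eq_abs, abs_of_nonneg (le_trans (by positivity) (hl w))]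
    exact hu w
  · intro ξ
    rw [fourier_eq_fourierSymbol, hs, Complex.ofReal_mul]
  · intro ξ
    rw [mul_assoc]
    refine mul_le_mul_of_nonneg_left ?_ (by positivity)
    have := hl ((2 * Real.pi) • ξ)
    rwa [norm_smul, Real.norm_of_nonneg (by positivity)] at this

/-- Continuity of `Φ` makes the inversion formula hold at every point, as is needed to evaluate it
at the finitely many differences of nodes. -/
theorem eq_integral_of_real_fourier (hcont : Continuous Φ) (hint : Integrable Φ)
    {g : EuclideanSpace ℝ (Fin d) → ℝ} (hg : Integrable g)
    (h : ∀ ξ, 𝓕 (fun x => (Φ x : ℂ)) ξ = (g ξ : ℂ)) (x : EuclideanSpace ℝ (Fin d)) :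
    (Φ x : ℂ) = ∫ ξ, (Real.fourierChar (inner ℝ ξ x) : ℂ) * (g ξ : ℂ) := by
  have hF : 𝓕 (fun x => (Φ x : ℂ)) = fun ξ => (g ξ : ℂ) := funext h
  have h1 := Continuous.fourierInv_fourier_eq (f := fun x => (Φ x : ℂ))
    (Complex.continuous_ofReal.comp hcont) hint.ofReal (by rw [hF]; exact hg.ofReal)
  rw [hF] at h1
  have h2 := congrFun h1 x
  rw [Real.fourierInv_eq] at h2
  rw [← h2]
  rfl

/-- The trigonometric polynomial `ξ ↦ ∑ x, α x e^{-2πi⟨x, ξ⟩}`. -/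
def trigSum {ι : Type*} [Fintype ι] (p : ι → EuclideanSpace ℝ (Fin d)) (α : ι → ℝ)
    (ξ : EuclideanSpace ℝ (Fin d)) : ℂ :=
  ∑ i, (α i : ℂ) * (Real.fourierChar (-inner ℝ (p i) ξ) : ℂ)

theorem continuous_trigSum {ι : Type*} [Fintype ι] (p : ι → EuclideanSpace ℝ (Fin d))
    (α : ι → ℝ) : Continuous (trigSum p α) := by
  refine continuous_finsetSum _ fun i _ => continuous_const.mul ?_
  exact continuous_subtype_val.comp (Real.continuous_fourierChar.comp (by fun_prop))

theorem norm_trigSum_le {ι : Type*} [Fintype ι] (p : ι → EuclideanSpace ℝ (Fin d))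
    (α : ι → ℝ) (ξ) : ‖trigSum p α ξ‖ ≤ ∑ i, |α i| := by
  refine (norm_sum_le _ _).trans (Finset.sum_le_sum fun i _ => ?_)
  rw [norm_mul, Circle.norm_coe, mul_one, Complex.norm_real, Real.norm_eq_abs]

theorem norm_trigSum_sq {ι : Type*} [Fintype ι] (p : ι → EuclideanSpace ℝ (Fin d))
    (α : ι → ℝ) (ξ : EuclideanSpace ℝ (Fin d)) :
    ((‖trigSum p α ξ‖ ^ 2 : ℝ) : ℂ) =
      ∑ i, ∑ j, (α i : ℂ) * (α j : ℂ) * (Real.fourierChar (inner ℝ ξ (p i - p j)) : ℂ) := by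
  rw [← Complex.normSq_eq_norm_sq, Complex.normSq_eq_conj_mul_self, trigSum, map_sum,
    Finset.sum_mul_sum]
  refine Finset.sum_congr rfl fun i _ => Finset.sum_congr rfl fun j _ => ?_
  have : (Real.fourierChar (inner ℝ ξ (p i - p j)) : ℂ) =
      (starRingEnd ℂ) (Real.fourierChar (-inner ℝ (p i) ξ) : ℂ) *
        (Real.fourierChar (-inner ℝ (p j) ξ) : ℂ) := by
    rw [← Circle.coe_inv_eq_conj, ← AddChar.map_neg_eq_inv, ← Circle.coe_mul,
      ← AddChar.map_add_eq_mul, neg_neg, inner_sub_right, real_inner_comm ξ, real_inner_comm ξ,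
      sub_eq_add_neg]
  rw [this, map_mul, Complex.conj_ofReal]
  ring

/-- The quadratic form of the kernel matrix as an integral on the Fourier side. -/
theorem sum_kernel_eq_integral (hcont : Continuous Φ) (hint : Integrable Φ)
    {g : EuclideanSpace ℝ (Fin d) → ℝ} (hg : Integrable g)
    (h : ∀ ξ, 𝓕 (fun x => (Φ x : ℂ)) ξ = (g ξ : ℂ)) {ι : Type*} [Fintype ι]
    (p : ι → EuclideanSpace ℝ (Fin d)) (α : ι → ℝ) :
    ∑ i, ∑ j, α i * α j * Φ (p i - p j) = ∫ ξ, g ξ * ‖trigSum p α ξ‖ ^ 2 := by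
  have hI : ∀ x : EuclideanSpace ℝ (Fin d),
      Integrable fun ξ => (Real.fourierChar (inner ℝ ξ x) : ℂ) * (g ξ : ℂ) := fun x => by
    refine hg.ofReal.bdd_mul (c := 1) (Continuous.aestronglyMeasurable ?_)
      (Eventually.of_forall fun ξ => (Circle.norm_coe _).le)
    exact continuous_subtype_val.comp (Real.continuous_fourierChar.comp (by fun_prop))
  have hJ : ∀ i j, Integrable fun ξ => (g ξ : ℂ) *
      ((α i : ℂ) * (α j : ℂ) * (Real.fourierChar (inner ℝ ξ (p i - p j)) : ℂ)) := fun i j => by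
    refine ((hI (p i - p j)).const_mul ((α i : ℂ) * α j)).congr (Eventually.of_forall fun ξ => ?_)
    simp only
    ring
  have key : ((∑ i, ∑ j, α i * α j * Φ (p i - p j) : ℝ) : ℂ) =
      ((∫ ξ, g ξ * ‖trigSum p α ξ‖ ^ 2 : ℝ) : ℂ) := by
    rw [← integral_complex_ofReal]
    simp_rw [Complex.ofReal_mul _ (_ ^ 2), norm_trigSum_sq, Finset.mul_sum]
    rw [integral_finsetSum _ fun i _ => integrable_finsetSum _ fun j _ => hJ i j]
    · push_cast
      refine Finset.sum_congr rfl fun i _ => ?_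
      rw [integral_finsetSum _ fun j _ => ?_]
      · refine Finset.sum_congr rfl fun j _ => ?_
        rw [eq_integral_of_real_fourier hcont hint hg h, ← integral_const_mul]
        congr 1
        funext ξ
        ring
      · exact hJ i j
  exact_mod_cast key

theorem integrable_mul_norm_trigSum_sq {g : EuclideanSpace ℝ (Fin d) → ℝ} (hg : Integrable g)
    {ι : Type*} [Fintype ι] (p : ι → EuclideanSpace ℝ (Fin d)) (α : ι → ℝ) :
    Integrable fun ξ => g ξ * ‖trigSum p α ξ‖ ^ 2 := by
  refine hg.mul_bdd (c := (∑ i, |α i|) ^ 2) ?_ (Eventually.of_forall fun ξ => ?_)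
  · exact ((continuous_trigSum p α).norm.pow 2).aestronglyMeasurable
  · rw [norm_pow, norm_norm]
    exact pow_le_pow_left₀ (norm_nonneg _) (norm_trigSum_le p α ξ) 2

/-- The kernel is symmetric because its Fourier transform is real. -/
theorem even_of_real_fourier (hcont : Continuous Φ) (hint : Integrable Φ)
    {g : EuclideanSpace ℝ (Fin d) → ℝ} (hg : Integrable g)
    (h : ∀ ξ, 𝓕 (fun x => (Φ x : ℂ)) ξ = (g ξ : ℂ)) (x : EuclideanSpace ℝ (Fin d)) :
    Φ (-x) = Φ x := by
  have key : (Φ (-x) : ℂ) = (Φ x : ℂ) := by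
    rw [← Complex.conj_ofReal (Φ x), eq_integral_of_real_fourier hcont hint hg h,
      eq_integral_of_real_fourier hcont hint hg h, ← integral_conj]
    congr 1
    funext ξ
    rw [map_mul, Complex.conj_ofReal, inner_neg_right, ← Circle.coe_inv_eq_conj,
      ← AddChar.map_neg_eq_inv]
  exact_mod_cast key

end Kernel

/-! ### Superpositions of translates with disjoint supports -/

section Translates

variable {d : ℕ} {ι : Type*} [Fintype ι]

/-- The superposition `∑ i, α i • v(· - p i)` of translates of `v`. -/
def sumTranslates {F : Type*} [AddCommGroup F] [Module ℝ F]
    (p : ι → EuclideanSpace ℝ (Fin d)) (α : ι → ℝ)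
    (v : EuclideanSpace ℝ (Fin d) → F) (x : EuclideanSpace ℝ (Fin d)) : F :=
  ∑ i, α i • v (x - p i)

/-- Translates with disjoint supports are orthogonal. -/
theorem integral_norm_sumTranslates_sq {F : Type*} [NormedAddCommGroup F] [InnerProductSpace ℝ F]
    {p : ι → EuclideanSpace ℝ (Fin d)} {r : ℝ} (hp : Pairwise fun i j => 2 * r ≤ dist (p i) (p j))
    (α : ι → ℝ) {v : EuclideanSpace ℝ (Fin d) → F}
    (hv : Function.support v ⊆ Metric.ball 0 r) (hint : Integrable fun x => ‖v x‖ ^ 2) :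
    ∫ x, ‖sumTranslates p α v x‖ ^ 2 = (∑ i, α i ^ 2) * ∫ x, ‖v x‖ ^ 2 := by
  -- Orthogonality is already pointwise: at each `x` at most one translate is nonzero. The balls are
  -- open, so centres at distance exactly `2 * r` are allowed.
  have hpt : ∀ x, ‖sumTranslates p α v x‖ ^ 2 = ∑ i, α i ^ 2 * ‖v (x - p i)‖ ^ 2 := fun x => by
    rw [sumTranslates, ← real_inner_self_eq_norm_sq, sum_inner]
    refine Finset.sum_congr rfl fun i _ => ?_
    rw [inner_sum, Finset.sum_eq_single i]
    · rw [real_inner_self_eq_norm_sq, norm_smul, mul_pow, Real.norm_eq_abs, sq_abs]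
    · intro j _ hji
      by_cases hi : v (x - p i) = 0
      · simp [hi]
      by_cases hj : v (x - p j) = 0
      · simp [hj]
      have h1 := hv hi
      have h2 := hv hj
      rw [mem_ball_zero_iff, ← dist_eq_norm] at h1 h2
      have h3 := hp hji
      have h4 := dist_triangle_left (p j) (p i) x
      linarith
    · simp
  simp_rw [hpt]
  rw [integral_finsetSum _ fun i _ => (hint.comp_sub_right (p i)).const_mul _, Finset.sum_mul]
  refine Finset.sum_congr rfl fun i _ => ?_
  rw [integral_const_mul, integral_sub_right_eq_self fun x => ‖v x‖ ^ 2]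

variable {U : Set (EuclideanSpace ℝ (Fin d))} {v : EuclideanSpace ℝ (Fin d) → ℝ}

/-- Only Plancherel is applied to the superposition, so the location of its support is irrelevant
and `Set.univ` suffices. -/
theorem IsTestFunction.sumTranslates (hv : IsTestFunction U v)
    (p : ι → EuclideanSpace ℝ (Fin d)) (α : ι → ℝ) :
    IsTestFunction Set.univ (sumTranslates p α v) where
  smooth := ContDiff.sum fun i _ => by
    have h : ContDiff ℝ ∞ fun x => v (x - p i) :=
      hv.smooth.comp (contDiff_id.sub contDiff_const)
    exact h.const_smul (α i)
  compact_support := by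
    have h : ∀ i, HasCompactSupport fun x => α i • v (x - p i) := fun i =>
      (hv.compact_support.comp_homeomorph (Homeomorph.subRight (p i))).smul_left
        (f := fun _ => α i)
    unfold _root_.sumTranslates
    classical
    induction (Finset.univ : Finset ι) using Finset.induction_on with
    | empty => exact HasCompactSupport.zero
    | insert i s hi ih =>
      simp_rw [Finset.sum_insert hi]
      exact (h i).add ih
  support_subset := Set.subset_univ _

theorem gradient_sumTranslates (hv : ContDiff ℝ ∞ v)
    (p : ι → EuclideanSpace ℝ (Fin d)) (α : ι → ℝ) (x : EuclideanSpace ℝ (Fin d)) :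
    gradient (sumTranslates p α v) x = sumTranslates p α (gradient v) x := by
  have h : HasFDerivAt (sumTranslates p α v) (∑ i, α i • fderiv ℝ v (x - p i)) x := by
    refine HasFDerivAt.fun_sum fun i _ => HasFDerivAt.fun_const_smul ?_ _
    have := ((hv.differentiable (by simp)) (x - p i)).hasFDerivAt
    exact this.comp x ((hasFDerivAt_id x).sub_const (p i))
  rw [gradient, h.fderiv, map_sum, sumTranslates]
  simp [gradient]

/-- Translation becomes modulation, so the factor is the same trigonometric sum as in the quadratic
form of the kernel. -/
theorem fourier_sumTranslates (hv : Integrable v)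
    (p : ι → EuclideanSpace ℝ (Fin d)) (α : ι → ℝ) (ξ : EuclideanSpace ℝ (Fin d)) :
    𝓕 (fun x => ((sumTranslates p α v x : ℝ) : ℂ)) ξ = trigSum p α ξ * 𝓕 (fun x => (v x : ℂ)) ξ := by
  have ht : ∀ a : EuclideanSpace ℝ (Fin d),
      ∫ x, (Real.fourierChar (-inner ℝ x ξ) : ℂ) * (v (x - a) : ℂ) =
        (Real.fourierChar (-inner ℝ a ξ) : ℂ) * 𝓕 (fun x => (v x : ℂ)) ξ := fun a => by
    rw [Real.fourier_eq, ← integral_const_mul, ← integral_add_right_eq_self _ a]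
    refine integral_congr_ae (Eventually.of_forall fun x => ?_)
    simp only [add_sub_cancel_right, inner_add_left, neg_add, AddChar.map_add_eq_mul,
      Circle.coe_mul, Circle.smul_def, smul_eq_mul]
    ring
  have hI : ∀ a : EuclideanSpace ℝ (Fin d),
      Integrable fun x => (Real.fourierChar (-inner ℝ x ξ) : ℂ) * (v (x - a) : ℂ) := fun a => by
    refine (hv.comp_sub_right a).ofReal.bdd_mul (c := 1) (Continuous.aestronglyMeasurable ?_)
      (Eventually.of_forall fun ξ => (Circle.norm_coe _).le)
    exact continuous_subtype_val.comp (Real.continuous_fourierChar.comp (by fun_prop))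
  rw [Real.fourier_eq, trigSum, Finset.sum_mul]
  simp_rw [mul_assoc, ← ht, ← integral_const_mul]
  rw [← integral_finsetSum _ fun i _ => (hI (p i)).const_mul _]
  refine integral_congr_ae (Eventually.of_forall fun x => ?_)
  simp only [sumTranslates, Circle.smul_def, smul_eq_mul, Complex.ofReal_sum, Complex.ofReal_mul,
    Finset.mul_sum]
  refine Finset.sum_congr rfl fun i _ => ?_
  ring

end Translates

/-! ### Volume of the ball and the sup norm of the Fourier transform -/

section SupNorm

variable {d : ℕ}

/-- The ball lies in a cube of side one. This gives the sup bound on Fourier transforms the constant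
one. -/
theorem volume_ball_half_le_one :
    volume (Metric.ball (0 : EuclideanSpace ℝ (Fin d)) (1 / 2)) ≤ 1 := by
  have hsub : Metric.ball (0 : EuclideanSpace ℝ (Fin d)) (1 / 2) ⊆
      (MeasurableEquiv.toLp 2 (Fin d → ℝ)).symm ⁻¹'
        (Set.univ.pi fun _ => Set.Icc (-(1 / 2)) (1 / 2)) := by
    intro x hx i _
    rw [mem_ball_zero_iff] at hx
    exact abs_le.mp (((PiLp.norm_apply_le x i).trans hx.le))
  refine (measure_mono hsub).trans ?_
  rw [(EuclideanSpace.volume_preserving_symm_measurableEquiv_toLp (Fin d)).measure_preimage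
    (MeasurableSet.univ_pi fun _ => measurableSet_Icc).nullMeasurableSet, volume_pi_pi]
  simp
  norm_num

/-- The Fourier transform of a function supported in a set of measure at most one is bounded by
its `L²`-norm. -/
theorem norm_fourier_sq_le_of_support {v : EuclideanSpace ℝ (Fin d) → ℝ}
    {s : Set (EuclideanSpace ℝ (Fin d))} (hs : MeasurableSet s) (hvol : volume s ≤ 1)
    (hv : MemLp v 2 volume)
    (hsupp : Function.support v ⊆ s) (ξ : EuclideanSpace ℝ (Fin d)) :
    ‖𝓕 (fun x => (v x : ℂ)) ξ‖ ^ 2 ≤ ∫ x, v x ^ 2 := by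
  have h1 : ‖𝓕 (fun x => (v x : ℂ)) ξ‖ ≤ ∫ x, ‖(v x : ℂ)‖ :=
    VectorFourier.norm_fourierIntegral_le_integral_norm _ _ _ _ _
  have hone : MemLp (s.indicator fun _ => (1 : ℝ)) 2 volume :=
    memLp_indicator_const 2 hs 1 (Or.inr (hvol.trans_lt ENNReal.one_lt_top).ne)
  -- Cauchy-Schwarz of `|v|` against the indicator of `s`, whose `L²`-norm is at most one.
  have h2 := integral_mul_le_Lp_mul_Lq_of_nonneg (μ := volume) Real.HolderConjugate.two_two
    (f := fun x => |v x|) (g := s.indicator fun _ => (1 : ℝ))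
    (Eventually.of_forall fun x => abs_nonneg _)
    (Eventually.of_forall fun x => Set.indicator_nonneg (fun _ _ => zero_le_one) x)
    (by simpa using! hv.abs) (by simpa using hone)
  have h3 : ∫ x, |v x| * s.indicator (fun _ => (1 : ℝ)) x = ∫ x, ‖(v x : ℂ)‖ := by
    refine integral_congr_ae (Eventually.of_forall fun x => ?_)
    by_cases hx : x ∈ s
    · simp [hx]
    · have : v x = 0 := by
        by_contra h
        exact hx (hsupp h)
      simp [this]
  have h4 : ∫ x, s.indicator (fun _ => (1 : ℝ)) x ^ (2 : ℝ) ≤ 1 := by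
    have : ∀ x, s.indicator (fun _ => (1 : ℝ)) x ^ (2 : ℝ) = s.indicator 1 x := fun x => by
      by_cases hx : x ∈ s <;> simp [hx]
    simp_rw [this]
    rw [integral_indicator_one hs]
    exact ENNReal.toReal_le_of_le_ofReal zero_le_one (by simpa using hvol)
  have h5 : ∫ x, |v x| ^ (2 : ℝ) = ∫ x, v x ^ 2 := by simp
  rw [h3, h5] at h2
  have hA : 0 ≤ ∫ x, v x ^ 2 := integral_nonneg fun x => sq_nonneg _
  have h6 : ∫ x, ‖(v x : ℂ)‖ ≤ (∫ x, v x ^ 2) ^ (1 / 2 : ℝ) := by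
    refine h2.trans (mul_le_of_le_one_right (by positivity) (Real.rpow_le_one ?_ h4 (by norm_num)))
    exact integral_nonneg fun x =>
      Real.rpow_nonneg (Set.indicator_nonneg (fun _ _ => zero_le_one) x) _
  calc ‖𝓕 (fun x => (v x : ℂ)) ξ‖ ^ 2 ≤ ((∫ x, v x ^ 2) ^ (1 / 2 : ℝ)) ^ 2 := by
        gcongr
        exact h1.trans h6
    _ = ∫ x, v x ^ 2 := by
        rw [← Real.sqrt_eq_rpow, Real.sq_sqrt hA]

end SupNorm

/-! ### Scaling -/

section Scaling

variable {d : ℕ} {u : EuclideanSpace ℝ (Fin d) → ℝ} {q : ℝ}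

theorem IsTestFunction.comp_inv_smul {r : ℝ} (hu : IsTestFunction (Metric.ball 0 r) u)
    (hq : 0 < q) : IsTestFunction (Metric.ball 0 (q * r)) fun x => u (q⁻¹ • x) where
  smooth := hu.smooth.comp (contDiff_const_smul _)
  compact_support :=
    hu.compact_support.comp_homeomorph (Homeomorph.smulOfNeZero q⁻¹ (inv_ne_zero hq.ne'))
  support_subset := by
    have h : tsupport (fun x => u (q⁻¹ • x)) =
        Homeomorph.smulOfNeZero q⁻¹ (inv_ne_zero hq.ne') ⁻¹' tsupport u :=
      tsupport_comp_eq_preimage u (Homeomorph.smulOfNeZero q⁻¹ (inv_ne_zero hq.ne'))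
    rw [h]
    intro x hx
    have := hu.support_subset hx
    rw [mem_ball_zero_iff] at this ⊢
    rw [Homeomorph.smulOfNeZero_apply, norm_smul, norm_inv, Real.norm_of_nonneg hq.le] at this
    rwa [inv_mul_lt_iff₀ hq] at this

theorem integral_comp_inv_smul_sq (u : EuclideanSpace ℝ (Fin d) → ℝ) (hq : 0 < q) :
    ∫ x, u (q⁻¹ • x) ^ 2 = q ^ d * ∫ x, u x ^ 2 := by
  rw [Measure.integral_comp_inv_smul volume (fun x => u x ^ 2) q]
  simp [abs_of_pos hq]

theorem integral_norm_gradient_comp_inv_smul_sq (u : EuclideanSpace ℝ (Fin d) → ℝ) (hq : 0 < q) :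
    ∫ x, ‖gradient (fun x => u (q⁻¹ • x)) x‖ ^ 2 =
      q ^ d * ((∫ x, ‖gradient u x‖ ^ 2) / q ^ 2) := by
  have h : ∀ x, ‖gradient (fun x => u (q⁻¹ • x)) x‖ ^ 2 =
      (q ^ 2)⁻¹ * ‖gradient u (q⁻¹ • x)‖ ^ 2 := fun x => by
    rw [gradient, fderiv_comp_smul, map_smul, norm_smul, mul_pow]
    simp [gradient]
  simp_rw [h]
  rw [integral_const_mul,
    Measure.integral_comp_inv_smul volume (fun x => ‖gradient u x‖ ^ 2) q]
  simp [abs_of_pos hq]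
  ring

theorem norm_fourier_comp_inv_smul (u : EuclideanSpace ℝ (Fin d) → ℝ) (hq : 0 < q)
    (ξ : EuclideanSpace ℝ (Fin d)) :
    ‖𝓕 (fun x => (u (q⁻¹ • x) : ℂ)) ξ‖ = q ^ d * ‖𝓕 (fun x => (u x : ℂ)) (q • ξ)‖ := by
  have h : 𝓕 (fun x => (u (q⁻¹ • x) : ℂ)) ξ = (q ^ d : ℝ) • 𝓕 (fun x => (u x : ℂ)) (q • ξ) := by
    rw [Real.fourier_eq, Real.fourier_eq]
    have := Measure.integral_comp_inv_smul volume
      (fun x => Real.fourierChar (-inner ℝ x (q • ξ)) • (u x : ℂ)) q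
    simp only [finrank_euclideanSpace_fin, abs_of_pos (pow_pos hq d)] at this
    rw [← this]
    congr 1
    funext x
    rw [real_inner_smul_left, real_inner_smul_right, inv_mul_cancel_left₀ hq.ne']
  rw [h, norm_smul, Real.norm_of_nonneg (by positivity)]

end Scaling

/-! ### The lower bound of the quadratic form -/

section QuadraticForm

variable {d : ℕ} {Φ : EuclideanSpace ℝ (Fin d) → ℝ} {cΦ CΦ τ : ℝ}

theorem norm_fourier_comp_inv_smul_sq_le {u : EuclideanSpace ℝ (Fin d) → ℝ}
    (hu : IsTestFunction (Metric.ball 0 (1 / 2)) u) {q : ℝ} (hq : 0 < q)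
    (ξ : EuclideanSpace ℝ (Fin d)) :
    ‖𝓕 (fun x => (u (q⁻¹ • x) : ℂ)) ξ‖ ^ 2 ≤ (q ^ d) ^ 2 * ∫ x, u x ^ 2 := by
  rw [norm_fourier_comp_inv_smul u hq, mul_pow]
  gcongr
  exact norm_fourier_sq_le_of_support measurableSet_ball volume_ball_half_le_one
    (hu.memLp 2) ((subset_tsupport u).trans hu.support_subset) _

/-- A band-limited minorant of the symbol of the kernel. -/
theorem symbol_minorant {g : EuclideanSpace ℝ (Fin d) → ℝ} {b M V : ℝ} (hb : 0 ≤ b) (hτ : 0 ≤ τ)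
    (hg : ∀ ξ, b * (1 + (2 * Real.pi * ‖ξ‖) ^ 2) ^ (-τ) ≤ g ξ) (hM : 0 < M) (hV : 0 < V)
    {t : ℝ} (ht : 0 ≤ t) (htV : t ≤ V) (ξ : EuclideanSpace ℝ (Fin d)) :
    b * (1 + M) ^ (-τ) / (M * V) * ((M - (2 * Real.pi * ‖ξ‖) ^ 2) * t) ≤ g ξ := by
  refine le_trans ?_ (hg ξ)
  set s := (2 * Real.pi * ‖ξ‖) ^ 2 with hs
  have hs0 : 0 ≤ s := sq_nonneg _
  rcases le_total s M with h | h
  -- Low frequencies: `(M - s) * t` is at most `M * V`, and the symbol bound decreases in `s`. In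
  -- the other case the left side is nonpositive.
  · calc b * (1 + M) ^ (-τ) / (M * V) * ((M - s) * t)
        ≤ b * (1 + M) ^ (-τ) / (M * V) * (M * V) := by
          gcongr
          linarith
      _ = b * (1 + M) ^ (-τ) := by field_simp
      _ ≤ b * (1 + s) ^ (-τ) := by
          gcongr b * ?_
          exact Real.rpow_le_rpow_of_nonpos (by positivity) (by linarith) (by linarith)
  · refine le_trans (mul_nonpos_of_nonneg_of_nonpos (by positivity) ?_) (by positivity)
    exact mul_nonpos_of_nonpos_of_nonneg (by linarith) ht

/-- Integrates the minorant with `M = m / q ^ 2` and `V = (q ^ d) ^ 2 * ∫ u²`, the sup bound for the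
rescaled function. The parameter `m` stays free, so `u` need not be an eigenfunction. -/
theorem quadraticForm_lower_bound (hτ : (d : ℝ) / 2 < τ) (hcΦ : 0 < cΦ)
    (hcont : Continuous Φ) (hint : Integrable Φ) (hdecay : FourierDecay Φ cΦ CΦ τ)
    {u : EuclideanSpace ℝ (Fin d) → ℝ} (hu : IsTestFunction (Metric.ball 0 (1 / 2)) u)
    (hN : 0 < ∫ x, u x ^ 2) {m q : ℝ} (hm : 0 < m) (hq : 0 < q)
    {ι : Type*} [Fintype ι] {p : ι → EuclideanSpace ℝ (Fin d)}
    (hp : Pairwise fun i j => q ≤ dist (p i) (p j)) (α : ι → ℝ) :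
    (2 * Real.pi) ^ ((d : ℝ) / 2) * cΦ * (1 + m / q ^ 2) ^ (-τ) / q ^ d *
        (1 - (∫ x, ‖gradient u x‖ ^ 2) / (m * ∫ x, u x ^ 2)) * ∑ i, α i ^ 2 ≤
      ∑ i, ∑ j, α i * α j * Φ (p i - p j) := by
  obtain ⟨g, hgint, hg, hgl⟩ := hdecay.exists_real_fourier hτ hcΦ hint
  set b := (2 * Real.pi) ^ ((d : ℝ) / 2) * cΦ with hb
  set N := ∫ x, u x ^ 2 with hNdef
  set R := ∫ x, ‖gradient u x‖ ^ 2 with hRdef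
  set v : EuclideanSpace ℝ (Fin d) → ℝ := fun x => u (q⁻¹ • x) with hv
  have hvt : IsTestFunction (Metric.ball 0 (q * (1 / 2))) v := hu.comp_inv_smul hq
  have hwt := hvt.sumTranslates p α
  have hp' : Pairwise fun i j => 2 * (q * (1 / 2)) ≤ dist (p i) (p j) := fun i j hij => by
    have := hp hij
    linarith
  have hτ0 : 0 ≤ τ := le_trans (by positivity) hτ.le
  have hb0 : 0 ≤ b := by positivity
  have hM : 0 < m / q ^ 2 := by positivity
  have hV : 0 < (q ^ d) ^ 2 * N := by positivity
  set A := b * (1 + m / q ^ 2) ^ (-τ) / (m / q ^ 2 * ((q ^ d) ^ 2 * N)) with hA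
  have hw2 : ∫ x, sumTranslates p α v x ^ 2 = (∑ i, α i ^ 2) * (q ^ d * N) := by
    have h := integral_norm_sumTranslates_sq hp' α (v := v)
      ((subset_tsupport v).trans hvt.support_subset) (by simpa using hvt.integrable_sq)
    simp only [Real.norm_eq_abs, sq_abs] at h
    rw [h, integral_comp_inv_smul_sq u hq]
  have hG2 : ∫ x, ‖gradient (sumTranslates p α v) x‖ ^ 2 =
      (∑ i, α i ^ 2) * (q ^ d * (R / q ^ 2)) := by
    simp_rw [gradient_sumTranslates hvt.smooth]
    rw [integral_norm_sumTranslates_sq hp' α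
      ((support_gradient_subset_tsupport v).trans hvt.support_subset)
      hvt.integrable_norm_gradient_sq, integral_norm_gradient_comp_inv_smul_sq u hq]
  rw [sum_kernel_eq_integral hcont hint hgint hg p α]
  have hI1 := hwt.integrable_norm_fourier_sq
  have hI2 := hwt.integrable_sq_mul_norm_fourier_sq
  calc b * (1 + m / q ^ 2) ^ (-τ) / q ^ d * (1 - R / (m * N)) * ∑ i, α i ^ 2
      = A * (m / q ^ 2 * ∫ ξ, ‖𝓕 (fun x => ((sumTranslates p α v x : ℝ) : ℂ)) ξ‖ ^ 2) -
        A * ∫ ξ, (2 * Real.pi * ‖ξ‖) ^ 2 *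
          ‖𝓕 (fun x => ((sumTranslates p α v x : ℝ) : ℂ)) ξ‖ ^ 2 := by
        rw [hwt.integral_norm_fourier_sq, hwt.integral_sq_mul_norm_fourier_sq, hw2, hG2, hA]
        field_simp
    _ = ∫ ξ, A * ((m / q ^ 2 - (2 * Real.pi * ‖ξ‖) ^ 2) *
          ‖𝓕 (fun x => ((sumTranslates p α v x : ℝ) : ℂ)) ξ‖ ^ 2) := by
        rw [← integral_const_mul, ← integral_const_mul, ← integral_const_mul,
          ← integral_sub ((hI1.const_mul _).const_mul _) (hI2.const_mul _)]
        congr 1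
        funext ξ
        ring
    _ ≤ ∫ ξ, g ξ * ‖trigSum p α ξ‖ ^ 2 := by
        refine integral_mono ?_ (integrable_mul_norm_trigSum_sq hgint p α) fun ξ => ?_
        · refine (((hI1.const_mul (m / q ^ 2)).sub hI2).const_mul A).congr
            (Eventually.of_forall fun ξ => ?_)
          simp only [Pi.sub_apply]
          ring
        · have h := symbol_minorant hb0 hτ0 hgl hM hV (sq_nonneg _)
            (norm_fourier_comp_inv_smul_sq_le hu hq ξ) ξ
          simp only
          rw [fourier_sumTranslates (memLp_one_iff_integrable.1 (hvt.memLp 1)), norm_mul, mul_pow ‖trigSum p α ξ‖]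
          calc A * ((m / q ^ 2 - (2 * Real.pi * ‖ξ‖) ^ 2) *
                (‖trigSum p α ξ‖ ^ 2 * ‖𝓕 (fun x => (v x : ℂ)) ξ‖ ^ 2))
              = A * ((m / q ^ 2 - (2 * Real.pi * ‖ξ‖) ^ 2) *
                ‖𝓕 (fun x => (v x : ℂ)) ξ‖ ^ 2) * ‖trigSum p α ξ‖ ^ 2 := by ring
            _ ≤ g ξ * ‖trigSum p α ξ‖ ^ 2 := by gcongr

end QuadraticForm

/-! ### The smallest eigenvalue of a symmetric matrix -/

section MinEigenvalue

theorem exists_isMinEigenvalue {ι : Type*} [Fintype ι] [DecidableEq ι] [Nonempty ι]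
    {A : Matrix ι ι ℝ} (hA : A.IsHermitian) : ∃ t, IsMinEigenvalue A t := by
  have hfin : Set.Finite {t : ℝ | Module.End.HasEigenvalue (Matrix.toLin' A) t} :=
    Module.End.finite_hasEigenvalue _
  have hne : {t : ℝ | Module.End.HasEigenvalue (Matrix.toLin' A) t}.Nonempty := by
    obtain ⟨i⟩ := ‹Nonempty ι›
    refine ⟨hA.eigenvalues i, Module.End.hasEigenvalue_of_hasEigenvector
      (x := ⇑(hA.eigenvectorBasis i)) ⟨?_, ?_⟩⟩
    · rw [Module.End.mem_eigenspace_iff, Matrix.toLin'_apply, hA.mulVec_eigenvectorBasis]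
    · intro h
      exact hA.eigenvectorBasis.orthonormal.ne_zero i (by ext j; exact congrFun h j)
  exact hfin.exists_minimal hne |>.imp fun t ht => ⟨ht.1, fun s hs => by
    rcases le_total t s with h | h
    · exact h
    · exact ht.2 hs h⟩

/-- The form bound is tested on an eigenvector for `t`. -/
theorem le_of_isMinEigenvalue {ι : Type*} [Fintype ι] [DecidableEq ι] {A : Matrix ι ι ℝ}
    {t B : ℝ} (ht : IsMinEigenvalue A t)
    (hB : ∀ α : ι → ℝ, B * ∑ i, α i ^ 2 ≤ ∑ i, ∑ j, α i * α j * A i j) : B ≤ t := by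
  obtain ⟨α, hα⟩ := Module.End.HasEigenvalue.exists_hasEigenvector ht.1
  have h1 : A.mulVec α = t • α := by simpa using hα.apply_eq_smul
  have hpos : 0 < ∑ i, α i ^ 2 := by
    obtain ⟨i, hi⟩ := Function.ne_iff.mp hα.2
    exact Finset.sum_pos' (fun _ _ => sq_nonneg _) ⟨i, Finset.mem_univ i, by
      have : α i ≠ 0 := hi
      positivity⟩
  refine le_of_mul_le_mul_right ((hB α).trans_eq ?_) hpos
  rw [Finset.mul_sum]
  refine Finset.sum_congr rfl fun i _ => ?_
  have h2 : ∑ j, A i j * α j = t * α i := congrFun h1 i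
  calc ∑ j, α i * α j * A i j = α i * ∑ j, A i j * α j := by
        rw [Finset.mul_sum]
        exact Finset.sum_congr rfl fun j _ => by ring
    _ = t * α i ^ 2 := by rw [h2]; ring

end MinEigenvalue

/-! ### Dirichlet eigenvalues and Rayleigh quotients of test functions -/

section Rayleigh

variable {d : ℕ} {U : Set (EuclideanSpace ℝ (Fin d))}

theorem inner_toLp_eq_integral {α F : Type*} [MeasurableSpace α] {ν : Measure α}
    [NormedAddCommGroup F] [InnerProductSpace ℝ F] {f g : α → F}
    (hf : MemLp f 2 ν) (hg : MemLp g 2 ν) :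
    inner ℝ (hf.toLp f) (hg.toLp g) = ∫ x, inner ℝ (f x) (g x) ∂ν := by
  rw [L2.inner_def]
  refine integral_congr_ae ?_
  filter_upwards [hf.coeFn_toLp, hg.coeFn_toLp] with x h1 h2
  rw [h1, h2]

theorem norm_toLp_sq_eq_integral {α F : Type*} [MeasurableSpace α] {ν : Measure α}
    [NormedAddCommGroup F] [InnerProductSpace ℝ F] {f : α → F} (hf : MemLp f 2 ν) :
    ‖hf.toLp f‖ ^ 2 = ∫ x, ‖f x‖ ^ 2 ∂ν := by
  rw [← real_inner_self_eq_norm_sq, inner_toLp_eq_integral]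
  simp

/-- A Dirichlet eigenvalue is a limit of Rayleigh quotients of test functions. -/
theorem IsDirichletEigenvalue.exists_rayleigh_lt {lam : ℝ} (h : IsDirichletEigenvalue U lam)
    {a : ℝ} (ha : lam < a) :
    ∃ v, IsTestFunction U v ∧ 0 < ∫ x, v x ^ 2 ∧
      ∫ x, ‖gradient v x‖ ^ 2 < a * ∫ x, v x ^ 2 := by
  obtain ⟨u, G, ⟨hu, hG, φ, hφ, hφu, hφG⟩, hu0, hweak⟩ := h
  have hconv : Tendsto (fun n => ((hφ n).memLp 2).toLp (φ n)) atTop (𝓝 (hu.toLp u)) :=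
    (Lp.tendsto_Lp_iff_tendsto_eLpNorm'' _ (fun n => (hφ n).memLp 2) u hu).2 hφu
  have hconvG : Tendsto (fun n => ((hφ n).memLp_gradient 2).toLp (gradient (φ n))) atTop
      (𝓝 (hG.toLp G)) :=
    (Lp.tendsto_Lp_iff_tendsto_eLpNorm'' _ (fun n => (hφ n).memLp_gradient 2) G hG).2 hφG
  -- The weak equation is tested with the approximants `φ n`; the limit amounts to testing with `u`
  -- itself.
  have hkey : ‖hG.toLp G‖ ^ 2 = lam * ‖hu.toLp u‖ ^ 2 := by
    have h1 : ∀ n, inner ℝ (hG.toLp G) (((hφ n).memLp_gradient 2).toLp (gradient (φ n))) =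
        lam * inner ℝ (hu.toLp u) (((hφ n).memLp 2).toLp (φ n)) := fun n => by
      rw [inner_toLp_eq_integral, inner_toLp_eq_integral, hweak _ (hφ n)]
      congr 2
      funext x
      simp [mul_comm]
    rw [← real_inner_self_eq_norm_sq, ← real_inner_self_eq_norm_sq]
    refine tendsto_nhds_unique (tendsto_const_nhds.inner hconvG) ?_
    simp_rw [h1]
    exact (tendsto_const_nhds.inner hconv).const_mul lam
  have hupos : 0 < ‖hu.toLp u‖ ^ 2 := by
    have : hu.toLp u ≠ 0 := fun h =>
      hu0 (hu.coeFn_toLp.symm.trans (Lp.eq_zero_iff_ae_eq_zero.1 h))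
    positivity
  have hlim1 := (hconv.norm.pow 2)
  have hlim2 := (hconvG.norm.pow 2)
  have hlt : ‖hG.toLp G‖ ^ 2 < a * ‖hu.toLp u‖ ^ 2 := by
    rw [hkey]
    gcongr
  have hev := (hlim2.eventually_lt (hlim1.const_mul a) hlt).and
    (hlim1.eventually (lt_mem_nhds hupos))
  obtain ⟨n, hn1, hn2⟩ := hev.exists
  rw [norm_toLp_sq_eq_integral, norm_toLp_sq_eq_integral] at hn1
  rw [norm_toLp_sq_eq_integral] at hn2
  simp only [Real.norm_eq_abs, sq_abs] at hn1 hn2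
  exact ⟨φ n, hφ n, hn2, hn1⟩

end Rayleigh

/-! ### Existence and positivity of the smallest Dirichlet eigenvalue -/

section Compactness

/-- Bounded sequences in a separable Hilbert space have weakly convergent subsequences. -/
theorem exists_subseq_tendsto_inner {H : Type*} [NormedAddCommGroup H] [InnerProductSpace ℝ H]
    [CompleteSpace H] [TopologicalSpace.SeparableSpace H] {a : ℕ → H} {C : ℝ}
    (ha : ∀ n, ‖a n‖ ≤ C) :
    ∃ (b : H) (k : ℕ → ℕ), StrictMono k ∧
      ∀ z, Tendsto (fun n => inner ℝ (a (k n)) z) atTop (𝓝 (inner ℝ b z)) := by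
  obtain ⟨f, -, k, hk, hf⟩ := WeakDual.isSeqCompact_closedBall ℝ H 0 C
    (x := fun n => StrongDual.toWeakDual (InnerProductSpace.toDual ℝ H (a n)))
    (fun n => by simpa using ha n)
  refine ⟨(InnerProductSpace.toDual ℝ H).symm (WeakDual.toStrongDual f), k, hk, fun z => ?_⟩
  rw [InnerProductSpace.toDual_symm_apply]
  exact ((WeakBilin.eval_continuous _ z).tendsto f).comp hf

variable {d : ℕ}

theorem IsTestFunction.add {U : Set (EuclideanSpace ℝ (Fin d))}
    {v w : EuclideanSpace ℝ (Fin d) → ℝ} (hv : IsTestFunction U v) (hw : IsTestFunction U w) :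
    IsTestFunction U (v + w) where
  smooth := hv.smooth.add hw.smooth
  compact_support := hv.compact_support.add hw.compact_support
  support_subset := (tsupport_add v w).trans (Set.union_subset hv.support_subset hw.support_subset)

theorem IsTestFunction.const_smul {U : Set (EuclideanSpace ℝ (Fin d))}
    {v : EuclideanSpace ℝ (Fin d) → ℝ} (hv : IsTestFunction U v) (t : ℝ) :
    IsTestFunction U (t • v) where
  smooth := hv.smooth.const_smul t
  compact_support := hv.compact_support.smul_left (f := fun _ => t)
  support_subset := (closure_mono (Function.support_const_smul_subset t v)).trans hv.support_subset

theorem IsTestFunction.zero (U : Set (EuclideanSpace ℝ (Fin d))) :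
    IsTestFunction U (0 : EuclideanSpace ℝ (Fin d) → ℝ) where
  smooth := contDiff_const
  compact_support := HasCompactSupport.zero
  support_subset := by simp

theorem gradient_add_of_contDiff {v w : EuclideanSpace ℝ (Fin d) → ℝ} (hv : ContDiff ℝ ∞ v)
    (hw : ContDiff ℝ ∞ w) : gradient (v + w) = gradient v + gradient w := by
  funext x
  simp only [gradient, Pi.add_apply]
  rw [fderiv_add (hv.differentiable (by simp) x) (hw.differentiable (by simp) x), map_add]

theorem gradient_const_smul_of_contDiff {v : EuclideanSpace ℝ (Fin d) → ℝ}
    (hv : ContDiff ℝ ∞ v) (t : ℝ) : gradient (t • v) = t • gradient v := by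
  funext x
  simp only [gradient, Pi.smul_apply]
  rw [fderiv_const_smul (hv.differentiable (by simp) x), map_smul]

/-- The pairs `(v, ∇v)` for test functions `v`, as a subspace of `L² × L²`. -/
def gradientGraph (U : Set (EuclideanSpace ℝ (Fin d))) :
    Submodule ℝ (Lp ℝ 2 (volume : Measure (EuclideanSpace ℝ (Fin d))) ×
      Lp (EuclideanSpace ℝ (Fin d)) 2 (volume : Measure (EuclideanSpace ℝ (Fin d)))) where
  carrier := {z | ∃ (v : EuclideanSpace ℝ (Fin d) → ℝ) (hv : IsTestFunction U v),
    z = ((hv.memLp 2).toLp v, (hv.memLp_gradient 2).toLp (gradient v))}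
  add_mem' := by
    rintro _ _ ⟨v, hv, rfl⟩ ⟨w, hw, rfl⟩
    refine ⟨v + w, hv.add hw, ?_⟩
    rw [Prod.mk_add_mk, ← MemLp.toLp_add, ← MemLp.toLp_add]
    simp_rw [gradient_add_of_contDiff hv.smooth hw.smooth]
  zero_mem' := by
    refine ⟨0, .zero U, ?_⟩
    have h : gradient (0 : EuclideanSpace ℝ (Fin d) → ℝ) = 0 := by
      simpa using gradient_const_smul_of_contDiff (v := (0 : EuclideanSpace ℝ (Fin d) → ℝ))
        contDiff_const 0
    simp_rw [h, MemLp.toLp_zero]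
    rfl
  smul_mem' := by
    rintro t _ ⟨v, hv, rfl⟩
    refine ⟨t • v, hv.const_smul t, ?_⟩
    rw [Prod.smul_mk, ← MemLp.toLp_const_smul, ← MemLp.toLp_const_smul]
    simp_rw [gradient_const_smul_of_contDiff hv.smooth]

theorem IsTestFunction.mem_gradientGraph {U : Set (EuclideanSpace ℝ (Fin d))}
    {v : EuclideanSpace ℝ (Fin d) → ℝ} (hv : IsTestFunction U v) :
    ((hv.memLp 2).toLp v, (hv.memLp_gradient 2).toLp (gradient v)) ∈ gradientGraph U :=
  ⟨v, hv, rfl⟩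

theorem norm_toLp_sq_eq_integral_sq {v : EuclideanSpace ℝ (Fin d) → ℝ} (hv : MemLp v 2 volume) :
    ‖hv.toLp v‖ ^ 2 = ∫ x, v x ^ 2 := by
  rw [norm_toLp_sq_eq_integral]
  simp

/-- Splitting the frequency integral of a test function at radius `r`. -/
theorem IsTestFunction.integral_sq_le_split {U : Set (EuclideanSpace ℝ (Fin d))}
    {v : EuclideanSpace ℝ (Fin d) → ℝ} (hv : IsTestFunction U v) {r : ℝ} (hr : 0 < r) :
    ∫ x, v x ^ 2 ≤ (∫ ξ in Metric.ball 0 r, ‖𝓕 (fun x => (v x : ℂ)) ξ‖ ^ 2) +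
      ((2 * Real.pi * r) ^ 2)⁻¹ * ∫ x, ‖gradient v x‖ ^ 2 := by
  rw [← hv.integral_norm_fourier_sq, ← hv.integral_sq_mul_norm_fourier_sq,
    ← integral_add_compl (measurableSet_ball (x := 0) (ε := r)) hv.integrable_norm_fourier_sq,
    ← integral_const_mul]
  gcongr
  refine (setIntegral_mono_on hv.integrable_norm_fourier_sq.integrableOn
    (hv.integrable_sq_mul_norm_fourier_sq.const_mul _).integrableOn measurableSet_ball.compl
    fun ξ hξ => ?_).trans (setIntegral_le_integral
      (hv.integrable_sq_mul_norm_fourier_sq.const_mul _)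
      (Eventually.of_forall fun ξ => by positivity))
  have hξ' : r ≤ ‖ξ‖ := by simpa using hξ
  rw [← mul_assoc]
  refine le_mul_of_one_le_left (sq_nonneg _) ?_
  rw [inv_mul_eq_div, one_le_div (by positivity)]
  gcongr

theorem IsTestFunction.norm_fourier_sq_le {v : EuclideanSpace ℝ (Fin d) → ℝ}
    (hv : IsTestFunction (Metric.ball 0 (1 / 2)) v) (ξ : EuclideanSpace ℝ (Fin d)) :
    ‖𝓕 (fun x => (v x : ℂ)) ξ‖ ^ 2 ≤ ∫ x, v x ^ 2 :=
  norm_fourier_sq_le_of_support measurableSet_ball volume_ball_half_le_one (hv.memLp 2)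
    ((subset_tsupport v).trans hv.support_subset) ξ

/-- The Poincaré inequality on the ball of radius `1 / 2`. -/
theorem exists_poincare (hd : 1 ≤ d) : ∃ δ : ℝ, 0 < δ ∧
    ∀ v : EuclideanSpace ℝ (Fin d) → ℝ, IsTestFunction (Metric.ball 0 (1 / 2)) v →
      δ * ∫ x, v x ^ 2 ≤ ∫ x, ‖gradient v x‖ ^ 2 := by
  have : Nonempty (Fin d) := ⟨⟨0, hd⟩⟩
  obtain ⟨r, hr, hvol⟩ : ∃ r : ℝ, 0 < r ∧
      volume.real (Metric.ball (0 : EuclideanSpace ℝ (Fin d)) r) ≤ 1 / 2 := by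
    -- Halving the radius 1/2 multiplies a volume of at most one by `(1 / 2) ^ d`, which is at most
    -- 1/2 because `1 ≤ d`.
    refine ⟨1 / 4, by norm_num, ?_⟩
    have h := Measure.addHaar_ball_mul_of_pos (volume : Measure (EuclideanSpace ℝ (Fin d))) 0
      (r := 1 / 2) (by norm_num) (1 / 2)
    have hle := volume_ball_half_le_one (d := d)
    rw [show (1 / 2 * (1 / 2) : ℝ) = 1 / 4 by norm_num] at h
    rw [Measure.real, h, ENNReal.toReal_mul, ENNReal.toReal_ofReal (by positivity),
      finrank_euclideanSpace_fin]
    have h1 : (1 / 2 : ℝ) ^ d ≤ 1 / 2 := by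
      simpa using pow_le_pow_of_le_one (by norm_num : (0 : ℝ) ≤ 1 / 2) (by norm_num) hd
    have h2 : (volume (Metric.ball (0 : EuclideanSpace ℝ (Fin d)) (1 / 2))).toReal ≤ 1 :=
      ENNReal.toReal_le_of_le_ofReal zero_le_one (by simpa using hle)
    exact (mul_le_of_le_one_right (by positivity) h2).trans h1
  -- Frequencies below `r` carry at most half of the `L²` mass, so the gradient controls the other
  -- half.
  refine ⟨(2 * Real.pi * r) ^ 2 / 2, by positivity, fun v hv => ?_⟩
  have h1 := hv.integral_sq_le_split hr
  have h2 : ∫ ξ in Metric.ball 0 r, ‖𝓕 (fun x => (v x : ℂ)) ξ‖ ^ 2 ≤ 1 / 2 * ∫ x, v x ^ 2 := by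
    calc ∫ ξ in Metric.ball 0 r, ‖𝓕 (fun x => (v x : ℂ)) ξ‖ ^ 2
        ≤ ∫ ξ in Metric.ball (0 : EuclideanSpace ℝ (Fin d)) r, ∫ x, v x ^ 2 :=
          integral_mono hv.integrable_norm_fourier_sq.integrableOn
            (integrableOn_const (s := Metric.ball 0 r) (C := ∫ x, v x ^ 2)
              measure_ball_lt_top.ne (by simp)) fun ξ => hv.norm_fourier_sq_le ξ
      _ = volume.real (Metric.ball (0 : EuclideanSpace ℝ (Fin d)) r) * ∫ x, v x ^ 2 := by simp
      _ ≤ 1 / 2 * ∫ x, v x ^ 2 := by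
          gcongr
  have h3 : 1 / 2 * ∫ x, v x ^ 2 ≤ ((2 * Real.pi * r) ^ 2)⁻¹ * ∫ x, ‖gradient v x‖ ^ 2 := by
    linarith
  rw [inv_mul_eq_div, le_div_iff₀ (by positivity)] at h3
  linarith

end Compactness

/-! ### Minimizers of an abstract Rayleigh quotient -/

section Minimization

/-- Minimizing sequences of a Rayleigh quotient whose first components converge have a limit that
solves the weak eigenvalue equation. -/
theorem exists_weak_eigenvector {H K : Type*} [NormedAddCommGroup H] [InnerProductSpace ℝ H]
    [CompleteSpace H] [NormedAddCommGroup K] [InnerProductSpace ℝ K] [CompleteSpace K]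
    (V : Submodule ℝ (H × K)) {lam : ℝ} (hlow : ∀ z ∈ V, lam * ‖z.1‖ ^ 2 ≤ ‖z.2‖ ^ 2)
    {z : ℕ → H × K} (hz : ∀ n, z n ∈ V) (hnorm : ∀ n, ‖(z n).1‖ = 1)
    (hlim : Tendsto (fun n => ‖(z n).2‖ ^ 2) atTop (𝓝 lam))
    (hcau : CauchySeq fun n => (z n).1) :
    ∃ (a : H) (b : K), ‖a‖ = 1 ∧ Tendsto (fun n => (z n).1) atTop (𝓝 a) ∧
      Tendsto (fun n => (z n).2) atTop (𝓝 b) ∧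
      ∀ y ∈ V, inner ℝ b y.2 = lam * inner ℝ a y.1 := by
  have hcau2 : CauchySeq fun n => (z n).2 := by
    rw [cauchySeq_iff_tendsto_dist_atTop_0] at hcau ⊢
    rw [← prod_atTop_atTop_eq] at hcau ⊢
    have hbound : ∀ p : ℕ × ℕ, dist (z p.1).2 (z p.2).2 ^ 2 ≤
        2 * (‖(z p.1).2‖ ^ 2 - lam) + 2 * (‖(z p.2).2‖ ^ 2 - lam) +
          lam * dist (z p.1).1 (z p.2).1 ^ 2 := fun p => by
      have h1 := hlow _ (V.add_mem (hz p.1) (hz p.2))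
      have h2 := parallelogram_law_with_norm ℝ (z p.1).1 (z p.2).1
      have h3 := parallelogram_law_with_norm ℝ (z p.1).2 (z p.2).2
      rw [hnorm, hnorm] at h2
      rw [dist_eq_norm, dist_eq_norm]
      simp only [Prod.fst_add, Prod.snd_add] at h1
      -- The parallelogram law for unit vectors turns the lower bound on the sum into an upper bound
      -- on the difference of the second components.
      have h4 : ‖(z p.1).1 + (z p.2).1‖ ^ 2 = 4 - ‖(z p.1).1 - (z p.2).1‖ ^ 2 := by linarith
      rw [h4] at h1
      linarith
    have hl1 : Tendsto (fun p : ℕ × ℕ => ‖(z p.1).2‖ ^ 2) (atTop ×ˢ atTop) (𝓝 lam) :=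
      hlim.comp tendsto_fst
    have hl2 : Tendsto (fun p : ℕ × ℕ => ‖(z p.2).2‖ ^ 2) (atTop ×ˢ atTop) (𝓝 lam) :=
      hlim.comp tendsto_snd
    have hr := (((hl1.sub_const lam).const_mul 2).add ((hl2.sub_const lam).const_mul 2)).add
      ((hcau.pow 2).const_mul lam)
    simp only [sub_self, mul_zero, add_zero, ne_eq, OfNat.ofNat_ne_zero, not_false_eq_true,
      zero_pow] at hr
    have hsq := squeeze_zero (fun p => sq_nonneg _) hbound hr
    have := hsq.sqrt
    simpa [Real.sqrt_sq dist_nonneg] using this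
  obtain ⟨a, ha⟩ := cauchySeq_tendsto_of_complete hcau
  obtain ⟨b, hb⟩ := cauchySeq_tendsto_of_complete hcau2
  have hna : ‖a‖ = 1 := tendsto_nhds_unique ha.norm (by simp [hnorm])
  have hnb : ‖b‖ ^ 2 = lam := tendsto_nhds_unique (hb.norm.pow 2) hlim
  refine ⟨a, b, hna, ha, hb, fun y hy => ?_⟩
  -- First variation: `‖b + t y.2‖² - lam ‖a + t y.1‖²` is nonnegative and vanishes at `t = 0`, so
  -- its linear coefficient must be zero.
  have hvar : ∀ t : ℝ, 0 ≤ 2 * t * (inner ℝ b y.2 - lam * inner ℝ a y.1) +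
      t ^ 2 * (‖y.2‖ ^ 2 - lam * ‖y.1‖ ^ 2) := fun t => by
    have h1 : lam * ‖a + t • y.1‖ ^ 2 ≤ ‖b + t • y.2‖ ^ 2 :=
      le_of_tendsto_of_tendsto' (((ha.add_const (t • y.1)).norm.pow 2).const_mul lam)
        ((hb.add_const (t • y.2)).norm.pow 2)
        fun n => hlow _ (V.add_mem (hz n) (V.smul_mem t hy))
    rw [norm_add_sq_real, norm_add_sq_real, hna, hnb, inner_smul_right, inner_smul_right,
      norm_smul, norm_smul, mul_pow, mul_pow, Real.norm_eq_abs, sq_abs] at h1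
    linarith
  set A := inner ℝ b y.2 - lam * inner ℝ a y.1 with hA
  have hC := hlow y hy
  set C := ‖y.2‖ ^ 2 - lam * ‖y.1‖ ^ 2 with hCdef
  have hC0 : 0 ≤ C := by linarith
  -- The parabola has its minimum at `-A / C`; the shift by one keeps the choice valid when `C = 0`.
  have h := hvar (-A / (C + 1))
  have hA0 : A ^ 2 ≤ 0 := by
    have h5 : 2 * (-A / (C + 1)) * A + (-A / (C + 1)) ^ 2 * C =
        -(A ^ 2 * (C + 2)) / (C + 1) ^ 2 := by
      field_simp
      ring
    rw [h5, div_nonneg_iff] at h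
    rcases h with h | h
    · nlinarith [sq_nonneg A]
    · nlinarith [h.2]
  have : A = 0 := by nlinarith
  linarith

end Minimization

/-! ### Rellich compactness via the Fourier transform -/

section Rellich

variable {d : ℕ}

/-- On functions supported in a bounded set, evaluating the Fourier transform at a point is given
by `L²` inner products. -/
theorem exists_fourier_eq_inner (ξ : EuclideanSpace ℝ (Fin d)) :
    ∃ c s : Lp ℝ 2 (volume : Measure (EuclideanSpace ℝ (Fin d))),
      ∀ (v : EuclideanSpace ℝ (Fin d) → ℝ) (hv : IsTestFunction (Metric.ball 0 (1 / 2)) v),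
        𝓕 (fun x => (v x : ℂ)) ξ =
          (inner ℝ ((hv.memLp 2).toLp v) c : ℝ) +
            (inner ℝ ((hv.memLp 2).toLp v) s : ℝ) * Complex.I := by
  set e : EuclideanSpace ℝ (Fin d) → ℂ := fun x => (Real.fourierChar (-inner ℝ x ξ) : ℂ) with he
  have hec : Continuous e :=
    continuous_subtype_val.comp (Real.continuous_fourierChar.comp (by fun_prop))
  -- The exponential is not square integrable; cutting it off to the ball makes it so and does not
  -- change its pairing with functions supported there.
  have hmem : ∀ f : EuclideanSpace ℝ (Fin d) → ℝ, Continuous f → (∀ x, |f x| ≤ 1) →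
      MemLp ((Metric.ball 0 (1 / 2)).indicator f) 2 volume := fun f hf h1 => by
    rw [memLp_indicator_iff_restrict measurableSet_ball]
    have : IsFiniteMeasure (volume.restrict
      (Metric.ball (0 : EuclideanSpace ℝ (Fin d)) (1 / 2))) :=
      isFiniteMeasure_restrict.2 measure_ball_lt_top.ne
    exact MemLp.of_bound hf.aestronglyMeasurable 1 (Eventually.of_forall h1)
  have hre := hmem (fun x => (e x).re) (Complex.continuous_re.comp hec)
    fun x => (Complex.abs_re_le_norm _).trans (Circle.norm_coe _).le
  have him := hmem (fun x => (e x).im) (Complex.continuous_im.comp hec)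
    fun x => (Complex.abs_im_le_norm _).trans (Circle.norm_coe _).le
  refine ⟨hre.toLp _, him.toLp _, fun v hv => ?_⟩
  have hI : Integrable fun x => e x * (v x : ℂ) := by
    refine (memLp_one_iff_integrable.1 (hv.memLp 1)).ofReal.bdd_mul (c := 1)
      hec.aestronglyMeasurable (Eventually.of_forall fun ξ => (Circle.norm_coe _).le)
  have hF : 𝓕 (fun x => (v x : ℂ)) ξ = ∫ x, e x * (v x : ℂ) := by
    rw [Real.fourier_eq]
    rfl
  have hzero : ∀ x, x ∉ Metric.ball (0 : EuclideanSpace ℝ (Fin d)) (1 / 2) → v x = 0 :=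
    fun x hx => by
      by_contra h
      exact hx (hv.support_subset (subset_tsupport v h))
  rw [inner_toLp_eq_integral, inner_toLp_eq_integral, hF, ← integral_re_add_im hI]
  have e1 : ∫ x, RCLike.re (e x * (v x : ℂ)) =
      ∫ x, inner ℝ (v x) ((Metric.ball 0 (1 / 2)).indicator (fun x => (e x).re) x) := by
    refine integral_congr_ae (Eventually.of_forall fun x => ?_)
    by_cases hx : x ∈ Metric.ball (0 : EuclideanSpace ℝ (Fin d)) (1 / 2)
    · simp only [Set.indicator_of_mem hx]
      simp
    · simp [hzero x hx]
  have e2 : ∫ x, RCLike.im (e x * (v x : ℂ)) =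
      ∫ x, inner ℝ (v x) ((Metric.ball 0 (1 / 2)).indicator (fun x => (e x).im) x) := by
    refine integral_congr_ae (Eventually.of_forall fun x => ?_)
    by_cases hx : x ∈ Metric.ball (0 : EuclideanSpace ℝ (Fin d)) (1 / 2)
    · simp only [Set.indicator_of_mem hx]
      simp
    · simp [hzero x hx]
  rw [e1, e2]
  rfl

/-- Rellich compactness on the ball: a sequence of test functions that is bounded in `H¹` has a
subsequence that is Cauchy in `L²`. -/
theorem exists_subseq_cauchySeq
    {z : ℕ → Lp ℝ 2 (volume : Measure (EuclideanSpace ℝ (Fin d))) ×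
      Lp (EuclideanSpace ℝ (Fin d)) 2 (volume : Measure (EuclideanSpace ℝ (Fin d)))}
    (hz : ∀ n, z n ∈ gradientGraph (Metric.ball 0 (1 / 2))) {B C : ℝ}
    (hB : ∀ n, ‖(z n).1‖ ≤ B) (hC : ∀ n, ‖(z n).2‖ ≤ C) :
    ∃ k : ℕ → ℕ, StrictMono k ∧ CauchySeq fun n => (z (k n)).1 := by
  have : Fact ((2 : ℝ≥0∞) ≠ ⊤) := ⟨ENNReal.ofNat_ne_top⟩
  obtain ⟨b, k, hk, hb⟩ := exists_subseq_tendsto_inner hB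
  refine ⟨k, hk, ?_⟩
  -- Differences are again test functions. Weak convergence sends their Fourier transforms to zero
  -- pointwise, and dominated convergence makes the integrals over balls vanish.
  have hdiff : ∀ p : ℕ × ℕ, z (k p.1) - z (k p.2) ∈ gradientGraph (Metric.ball 0 (1 / 2)) :=
    fun p => (gradientGraph _).sub_mem (hz _) (hz _)
  choose v hv hveq using hdiff
  have hv1 : ∀ p, ((hv p).memLp 2).toLp (v p) = (z (k p.1)).1 - (z (k p.2)).1 := fun p =>
    (congrArg Prod.fst (hveq p)).symm
  have hv2 : ∀ p, ((hv p).memLp_gradient 2).toLp (gradient (v p)) =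
      (z (k p.1)).2 - (z (k p.2)).2 := fun p => (congrArg Prod.snd (hveq p)).symm
  have hN : ∀ p, ∫ x, v p x ^ 2 ≤ (2 * B) ^ 2 := fun p => by
    rw [← norm_toLp_sq_eq_integral_sq ((hv p).memLp 2), hv1]
    gcongr
    exact (norm_sub_le _ _).trans (by linarith [hB (k p.1), hB (k p.2)])
  have hR : ∀ p, ∫ x, ‖gradient (v p) x‖ ^ 2 ≤ (2 * C) ^ 2 := fun p => by
    rw [← norm_toLp_sq_eq_integral ((hv p).memLp_gradient 2), hv2]
    gcongr
    exact (norm_sub_le _ _).trans (by linarith [hC (k p.1), hC (k p.2)])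
  have hpt : ∀ ξ, Tendsto (fun p => 𝓕 (fun x => (v p x : ℂ)) ξ) (atTop ×ˢ atTop) (𝓝 0) :=
    fun ξ => by
      obtain ⟨c, s, hcs⟩ := exists_fourier_eq_inner ξ
      have hlim : ∀ y, Tendsto (fun p : ℕ × ℕ => inner ℝ (((hv p).memLp 2).toLp (v p)) y)
          (atTop ×ˢ atTop) (𝓝 0) := fun y => by
        simp_rw [hv1, inner_sub_left]
        have := ((hb y).comp tendsto_fst).sub ((hb y).comp (tendsto_snd (f := atTop) (g := atTop)))
        simpa using this
      simp_rw [fun p => hcs (v p) (hv p)]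
      have h1 := (Complex.continuous_ofReal.tendsto 0).comp (hlim c)
      have h2 := ((Complex.continuous_ofReal.tendsto 0).comp (hlim s)).mul_const Complex.I
      simpa using h1.add h2
  have hball : ∀ r : ℝ, Tendsto (fun p => ∫ ξ in Metric.ball 0 r, ‖𝓕 (fun x => (v p x : ℂ)) ξ‖ ^ 2)
      (atTop ×ˢ atTop) (𝓝 0) := fun r => by
    have h := tendsto_integral_filter_of_dominated_convergence
      (μ := volume.restrict (Metric.ball (0 : EuclideanSpace ℝ (Fin d)) r))
      (l := (atTop ×ˢ atTop : Filter (ℕ × ℕ)))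
      (F := fun p ξ => ‖𝓕 (fun x => (v p x : ℂ)) ξ‖ ^ 2) (f := fun _ => 0)
      (fun _ => (2 * B) ^ 2)
      (Eventually.of_forall fun p =>
        (hv p).integrable_norm_fourier_sq.integrableOn.aestronglyMeasurable)
      (Eventually.of_forall fun p => Eventually.of_forall fun ξ => by
        rw [Real.norm_of_nonneg (sq_nonneg _)]
        exact ((hv p).norm_fourier_sq_le ξ).trans (hN p))
      (integrableOn_const (s := Metric.ball 0 r) (C := (2 * B) ^ 2)
        measure_ball_lt_top.ne enorm_ne_top)
      (Eventually.of_forall fun ξ => by simpa using (hpt ξ).norm.pow 2)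
    simpa using h
  rw [cauchySeq_iff_tendsto_dist_atTop_0, ← prod_atTop_atTop_eq]
  have hsq : Tendsto (fun p : ℕ × ℕ => dist (z (k p.1)).1 (z (k p.2)).1 ^ 2)
      (atTop ×ˢ atTop) (𝓝 0) := by
    rw [Metric.tendsto_nhds]
    intro ε hε
    -- The gradient bound makes the mass at frequencies beyond `r` small uniformly in the pair `p`.
    obtain ⟨r, hr, hrC⟩ : ∃ r : ℝ, 0 < r ∧ ((2 * Real.pi * r) ^ 2)⁻¹ * (2 * C) ^ 2 < ε / 2 := by
      have hlim : Tendsto (fun r : ℝ => ((2 * Real.pi * r) ^ 2)⁻¹ * (2 * C) ^ 2) atTop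
          (𝓝 (0 * (2 * C) ^ 2)) := by
        refine Tendsto.mul_const _ (tendsto_inv_atTop_zero.comp ?_)
        exact (tendsto_pow_atTop two_ne_zero).comp
          (tendsto_id.const_mul_atTop (by positivity))
      rw [zero_mul] at hlim
      exact ((eventually_gt_atTop 0).and (hlim.eventually (gt_mem_nhds (half_pos hε)))).exists
    filter_upwards [(hball r).eventually (gt_mem_nhds (half_pos hε))] with p hp
    rw [Real.dist_eq, sub_zero, abs_of_nonneg (sq_nonneg _), dist_eq_norm, ← hv1,
      norm_toLp_sq_eq_integral_sq]
    have h1 := (hv p).integral_sq_le_split hr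
    have h2 : ((2 * Real.pi * r) ^ 2)⁻¹ * ∫ x, ‖gradient (v p) x‖ ^ 2 ≤
        ((2 * Real.pi * r) ^ 2)⁻¹ * (2 * C) ^ 2 := by
      gcongr
      exact hR p
    linarith
  have := hsq.sqrt
  simpa [Real.sqrt_sq dist_nonneg] using this

end Rellich

/-! ### Existence and positivity of the smallest Dirichlet eigenvalue -/

section DirichletEigenvalue

variable {d : ℕ}

theorem exists_isTestFunction_integral_sq_pos (d : ℕ) :
    ∃ v : EuclideanSpace ℝ (Fin d) → ℝ, IsTestFunction (Metric.ball 0 (1 / 2)) v ∧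
      0 < ∫ x, v x ^ 2 := by
  let f : ContDiffBump (0 : EuclideanSpace ℝ (Fin d)) := ⟨1 / 8, 1 / 4, by norm_num, by norm_num⟩
  have hf : IsTestFunction (Metric.ball 0 (1 / 2)) f :=
    ⟨f.contDiff, f.hasCompactSupport, by
      rw [f.tsupport_eq]
      exact Metric.closedBall_subset_ball (by norm_num)⟩
  refine ⟨f, hf, ?_⟩
  refine (f.continuous.pow 2).integral_pos_of_hasCompactSupport_nonneg_nonzero
    (f.hasCompactSupport.comp_left (g := fun t : ℝ => t ^ 2) (by simp))
    (fun x => sq_nonneg _) (x := 0) ?_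
  simp [f.one_of_mem_closedBall (Metric.mem_closedBall_self f.rIn_pos.le)]

/-- The infimum of the Rayleigh quotient is attained and is a Dirichlet eigenvalue. -/
theorem exists_isDirichletEigenvalue (d : ℕ) :
    ∃ lam, IsDirichletEigenvalue (Metric.ball (0 : EuclideanSpace ℝ (Fin d)) (1 / 2)) lam := by
  set V := gradientGraph (Metric.ball (0 : EuclideanSpace ℝ (Fin d)) (1 / 2)) with hV
  set S : Set ℝ := {t | ∃ z ∈ V, ‖z.1‖ = 1 ∧ t = ‖z.2‖ ^ 2} with hS
  have hbdd : BddBelow S := ⟨0, by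
    rintro _ ⟨z, -, -, rfl⟩
    exact sq_nonneg _⟩
  have hscale : ∀ z ∈ V, z.1 ≠ 0 → ‖z.2‖ ^ 2 / ‖z.1‖ ^ 2 ∈ S := fun z hz h0 => by
    refine ⟨‖z.1‖⁻¹ • z, V.smul_mem _ hz, ?_, ?_⟩
    · rw [Prod.smul_fst, norm_smul, norm_inv, norm_norm, inv_mul_cancel₀ (norm_ne_zero_iff.2 h0)]
    · rw [Prod.smul_snd, norm_smul, norm_inv, norm_norm]
      ring
  have hne : S.Nonempty := by
    obtain ⟨v, hv, hpos⟩ := exists_isTestFunction_integral_sq_pos d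
    refine ⟨_, hscale _ hv.mem_gradientGraph fun h => ?_⟩
    rw [← norm_toLp_sq_eq_integral_sq (hv.memLp 2)] at hpos
    simp only at h
    simp [h] at hpos
  have hlow : ∀ z ∈ V, sInf S * ‖z.1‖ ^ 2 ≤ ‖z.2‖ ^ 2 := fun z hz => by
    by_cases h0 : z.1 = 0
    · simp [h0]
    · have := norm_pos_iff.2 h0
      exact (le_div_iff₀ (by positivity)).1 (csInf_le hbdd (hscale z hz h0))
  obtain ⟨t, -, htlim, htS⟩ := exists_seq_tendsto_sInf hne hbdd
  choose z hzV hz1 hz2 using htS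
  obtain ⟨B, hB⟩ : ∃ B, ∀ n, ‖(z n).2‖ ≤ B := by
    obtain ⟨B, hB⟩ := htlim.bddAbove_range
    refine ⟨√B, fun n => Real.le_sqrt_of_sq_le ?_⟩
    rw [← hz2]
    exact hB ⟨n, rfl⟩
  obtain ⟨k, hk, hcau⟩ := exists_subseq_cauchySeq hzV (fun n => (hz1 n).le) hB
  obtain ⟨a, b, hna, ha, hb, hweak⟩ := exists_weak_eigenvector V hlow (fun n => hzV (k n))
    (fun n => hz1 (k n)) (by simpa only [Function.comp_def, hz2] using htlim.comp hk.tendsto_atTop)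
    hcau
  -- The minimizing sequence consists of test functions with their gradients, so it is itself the
  -- approximation required by `IsH10`.
  choose φ hφ hφz using fun n => hzV (k n)
  refine ⟨sInf S, a, b, ⟨Lp.memLp a, Lp.memLp b, φ, hφ, ?_, ?_⟩, fun h0 => ?_, fun v hv => ?_⟩
  · refine (Lp.tendsto_Lp_iff_tendsto_eLpNorm'' _ (fun n => (hφ n).memLp 2) a (Lp.memLp a)).1 ?_
    rw [Lp.toLp_coeFn]
    simpa only [hφz] using ha
  · refine (Lp.tendsto_Lp_iff_tendsto_eLpNorm'' _ (fun n => (hφ n).memLp_gradient 2) b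
      (Lp.memLp b)).1 ?_
    rw [Lp.toLp_coeFn]
    simpa only [hφz] using hb
  · rw [← Lp.eq_zero_iff_ae_eq_zero] at h0
    simp [h0] at hna
  · have h := hweak _ hv.mem_gradientGraph
    have h1 := inner_toLp_eq_integral (Lp.memLp b) (hv.memLp_gradient 2)
    have h2 := inner_toLp_eq_integral (Lp.memLp a) (hv.memLp 2)
    rw [Lp.toLp_coeFn] at h1 h2
    simp only [h1, h2] at h
    rw [h]
    congr 2
    funext x
    simp [mul_comm]

/-- Existence of an eigenvalue is essential, since `sInf ∅ = 0` in `ℝ`. An eigenvalue below the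
Poincaré constant would yield a test function violating the inequality. -/
theorem dirichletLambdaMin_pos (hd : 1 ≤ d) : 0 < dirichletLambdaMin d := by
  obtain ⟨δ, hδ, hp⟩ := exists_poincare hd
  refine hδ.trans_le (le_csInf (exists_isDirichletEigenvalue d) fun lam hlam => ?_)
  by_contra! hlt
  obtain ⟨v, hv, hpos, hR⟩ := IsDirichletEigenvalue.exists_rayleigh_lt hlam hlt
  exact (hp v hv).not_gt hR

theorem exists_rayleigh_lt_of_dirichletLambdaMin_lt {a : ℝ} (ha : dirichletLambdaMin d < a) :
    ∃ v : EuclideanSpace ℝ (Fin d) → ℝ, IsTestFunction (Metric.ball 0 (1 / 2)) v ∧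
      0 < ∫ x, v x ^ 2 ∧ ∫ x, ‖gradient v x‖ ^ 2 < a * ∫ x, v x ^ 2 := by
  obtain ⟨lam, hlam, hlt⟩ := exists_lt_of_csInf_lt (exists_isDirichletEigenvalue d) ha
  exact IsDirichletEigenvalue.exists_rayleigh_lt hlam hlt

end DirichletEigenvalue

/-! ### Constants and the eigenvalue bounds -/

section Main

variable {d : ℕ}

theorem c0_sq (d : ℕ) (h : 0 ≤ dirichletLambdaMin d) : c0 d ^ 2 = 2 * dirichletLambdaMin d := by
  rw [c0, mul_pow, Real.sq_sqrt (by norm_num), Real.sq_sqrt h]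

/-- The powers of the Dirichlet eigenvalue cancel, so the prefactor in the main estimate is just `cΦ
/ 2`. -/
theorem c0_pow_mul_c1 (h : 0 < dirichletLambdaMin d) :
    c0 d ^ d * c1 d = (2 * Real.pi) ^ ((d : ℝ) / 2) / 2 := by
  have h0 : c0 d ^ d = 2 ^ ((d : ℝ) / 2) * dirichletLambdaMin d ^ ((d : ℝ) / 2) := by
    rw [c0, mul_pow, Real.sqrt_eq_rpow, Real.sqrt_eq_rpow, ← Real.rpow_mul_natCast (by norm_num),
      ← Real.rpow_mul_natCast h.le]
    congr 2 <;> ring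
  have := Real.rpow_pos_of_pos h ((d : ℝ) / 2)
  rw [h0, c1, Real.mul_rpow (by norm_num) Real.pi_pos.le]
  field_simp

theorem rpow_sub_two_mul_eq {q m τ : ℝ} (hq : 0 < q) (hm : 0 ≤ m) (d : ℕ) :
    (q ^ 2 + m) ^ (-τ) * q ^ (2 * τ - (d : ℝ)) = (1 + m / q ^ 2) ^ (-τ) / q ^ d := by
  have h1 : q ^ 2 + m = q ^ 2 * (1 + m / q ^ 2) := by field_simp
  rw [h1, Real.mul_rpow (by positivity) (by positivity), Real.rpow_sub hq, Real.rpow_natCast,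
    ← Real.rpow_natCast q 2, ← Real.rpow_mul hq.le]
  have h2 : q ^ (((2 : ℕ) : ℝ) * -τ) * q ^ (2 * τ) = 1 := by
    rw [← Real.rpow_add hq]
    simp
  calc q ^ (((2 : ℕ) : ℝ) * -τ) * (1 + m / q ^ ((2 : ℕ) : ℝ)) ^ (-τ) * (q ^ (2 * τ) / q ^ d)
      = q ^ (((2 : ℕ) : ℝ) * -τ) * q ^ (2 * τ) * ((1 + m / q ^ ((2 : ℕ) : ℝ)) ^ (-τ) / q ^ d) := by
        ring
    _ = _ := by rw [h2, one_mul]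

theorem sepDist_pos {X : Finset (EuclideanSpace ℝ (Fin d))} (hX : 2 ≤ X.card) :
    0 < sepDist X :=
  (Finset.infsep_pos_iff_nontrivial X).2 (Finset.one_lt_card_iff_nontrivial.1 hX)

variable {Φ : EuclideanSpace ℝ (Fin d) → ℝ} {cΦ CΦ τ : ℝ}

theorem exists_isMinEigenvalue_kernelMatrix (hτ : (d : ℝ) / 2 < τ) (hcΦ : 0 < cΦ)
    (hcont : Continuous Φ) (hint : Integrable Φ) (hdecay : FourierDecay Φ cΦ CΦ τ)
    {k : EuclideanSpace ℝ (Fin d) → EuclideanSpace ℝ (Fin d) → ℝ}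
    (hk : ∀ x z, k x z = Φ (x - z)) {X : Finset (EuclideanSpace ℝ (Fin d))} (hX : 2 ≤ X.card) :
    ∃ t, IsMinEigenvalue (kernelMatrix k X) t := by
  have : Nonempty X := (Finset.card_pos.1 (by omega)).to_subtype
  refine exists_isMinEigenvalue (Matrix.IsHermitian.ext fun i j => ?_)
  obtain ⟨g, hg, hF, -⟩ := hdecay.exists_real_fourier hτ hcΦ hint
  have h := even_of_real_fourier hcont hint hg hF ((i : EuclideanSpace ℝ (Fin d)) - j)
  rw [neg_sub] at h
  simp [kernelMatrix, hk, h]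

/-- Lower bound for the smallest eigenvalue of the kernel matrix in terms of the Rayleigh quotient
of a test function. -/
theorem isMinEigenvalue_lower_bound (hτ : (d : ℝ) / 2 < τ) (hcΦ : 0 < cΦ)
    (hcont : Continuous Φ) (hint : Integrable Φ) (hdecay : FourierDecay Φ cΦ CΦ τ)
    {k : EuclideanSpace ℝ (Fin d) → EuclideanSpace ℝ (Fin d) → ℝ}
    (hk : ∀ x z, k x z = Φ (x - z)) {X : Finset (EuclideanSpace ℝ (Fin d))} (hX : 2 ≤ X.card)
    {u : EuclideanSpace ℝ (Fin d) → ℝ} (hu : IsTestFunction (Metric.ball 0 (1 / 2)) u)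
    (hN : 0 < ∫ x, u x ^ 2) {m : ℝ} (hm : 0 < m) {t : ℝ}
    (ht : IsMinEigenvalue (kernelMatrix k X) t) :
    (2 * Real.pi) ^ ((d : ℝ) / 2) * (1 - (∫ x, ‖gradient u x‖ ^ 2) / (m * ∫ x, u x ^ 2)) * cΦ *
      (sepDist X ^ 2 + m) ^ (-τ) * sepDist X ^ (2 * τ - (d : ℝ)) ≤ t := by
  refine le_of_isMinEigenvalue ht fun α => ?_
  have h := quadraticForm_lower_bound hτ hcΦ hcont hint hdecay hu hN hm (sepDist_pos hX)
    (p := fun x : X => (x : EuclideanSpace ℝ (Fin d)))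
    (fun x y hxy => Set.infsep_le_dist_of_mem x.2 y.2 fun h => hxy (Subtype.ext h)) α
  rw [mul_assoc _ ((sepDist X ^ 2 + m) ^ (-τ)), rpow_sub_two_mul_eq (sepDist_pos hX) hm.le]
  calc _ = _ := by ring
    _ ≤ _ := h
    _ = _ := by simp [kernelMatrix, hk]

/-- The worst case is `d = 1`, where `2π > 25/4`. This slack allows near-minimizing test functions
in place of an eigenfunction. -/
theorem five_halves_le_rpow (hd : 1 ≤ d) : 5 / 2 ≤ (2 * Real.pi) ^ ((d : ℝ) / 2) := by
  have hpi := Real.pi_gt_d2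
  calc (5 / 2 : ℝ) ≤ (2 * Real.pi) ^ (1 / 2 : ℝ) := by
        rw [← Real.sqrt_eq_rpow]
        exact Real.le_sqrt_of_sq_le (by linarith)
    _ ≤ (2 * Real.pi) ^ ((d : ℝ) / 2) := by
        refine Real.rpow_le_rpow_of_exponent_le (by linarith) ?_
        have : (1 : ℝ) ≤ d := by exact_mod_cast hd
        linarith

theorem sepDist_le_of_subset_closedBall {X : Finset (EuclideanSpace ℝ (Fin d))} (hX : 2 ≤ X.card)
    {r : ℝ} (hr : (X : Set (EuclideanSpace ℝ (Fin d))) ⊆ Metric.closedBall 0 r) :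
    sepDist X ≤ 2 * r := by
  obtain ⟨x, hx, y, hy, hxy⟩ := Finset.one_lt_card.1 hX
  refine (Set.infsep_le_dist_of_mem hx hy hxy).trans ?_
  have h1 := mem_closedBall_zero_iff.1 (hr hx)
  have h2 := mem_closedBall_zero_iff.1 (hr hy)
  rw [dist_eq_norm]
  exact (norm_sub_le x y).trans (by linarith)

end Main

theorem mainTheorem7 (d : ℕ) (hd : 1 ≤ d) (τ cΦ CΦ : ℝ) (hτ : (d : ℝ) / 2 < τ)
    (hcΦ : 0 < cΦ) (hCΦ : 0 < CΦ)
    (Φ : EuclideanSpace ℝ (Fin d) → ℝ) (hcont : Continuous Φ) (hint : MeasureTheory.Integrable Φ)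
    (hdecay : FourierDecay Φ cΦ CΦ τ)
    (k : EuclideanSpace ℝ (Fin d) → EuclideanSpace ℝ (Fin d) → ℝ)
    (hk : ∀ x z, k x z = Φ (x - z)) :
    (∀ X : Finset (EuclideanSpace ℝ (Fin d)), 2 ≤ X.card →
      ∃ lam : ℝ, IsMinEigenvalue (kernelMatrix k X) lam ∧
        c0 d ^ d * c1 d * cΦ / (2 * Real.pi) ^ ((d : ℝ) / 2) *
            (sepDist X ^ 2 + c0 d ^ 2) ^ (-τ) * sepDist X ^ (2 * τ - (d : ℝ)) ≤ lam) ∧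
    (∀ Ω : Set (EuclideanSpace ℝ (Fin d)), Bornology.IsBounded Ω →
      ∃ c : ℝ, 0 < c ∧ ∀ X : Finset (EuclideanSpace ℝ (Fin d)),
        (X : Set (EuclideanSpace ℝ (Fin d))) ⊆ Ω → 2 ≤ X.card →
        ∃ lam : ℝ, IsMinEigenvalue (kernelMatrix k X) lam ∧
          c * sepDist X ^ (2 * τ - (d : ℝ)) ≤ lam) := by
  have hlam := dirichletLambdaMin_pos hd
  have hc0 := c0_sq d hlam.le
  have hτ0 : 0 ≤ τ := le_trans (by positivity) hτ.le
  have hfirst : ∀ X : Finset (EuclideanSpace ℝ (Fin d)), 2 ≤ X.card →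
      ∃ lam : ℝ, IsMinEigenvalue (kernelMatrix k X) lam ∧
        c0 d ^ d * c1 d * cΦ / (2 * Real.pi) ^ ((d : ℝ) / 2) *
            (sepDist X ^ 2 + c0 d ^ 2) ^ (-τ) * sepDist X ^ (2 * τ - (d : ℝ)) ≤ lam := by
    intro X hX
    obtain ⟨t, ht⟩ := exists_isMinEigenvalue_kernelMatrix hτ hcΦ hcont hint hdecay hk hX
    -- With `c₀² = 2 λ_min`, a Rayleigh quotient below `6/5 λ_min` leaves the factor `1 - 3/5 =
    -- 2/5`, and `5/2 * 2/5 = 1` exceeds the required 1/2.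
    obtain ⟨u, hu, hN, hR⟩ := exists_rayleigh_lt_of_dirichletLambdaMin_lt
      (show dirichletLambdaMin d < 6 / 5 * dirichletLambdaMin d by linarith)
    refine ⟨t, ht, le_trans ?_ (isMinEigenvalue_lower_bound hτ hcΦ hcont hint hdecay hk hX hu hN
      (m := c0 d ^ 2) (by rw [hc0]; positivity) ht)⟩
    have hq := sepDist_pos hX
    have hquot : 2 / 5 ≤ 1 - (∫ x, ‖gradient u x‖ ^ 2) / (c0 d ^ 2 * ∫ x, u x ^ 2) := by
      have : (∫ x, ‖gradient u x‖ ^ 2) / (c0 d ^ 2 * ∫ x, u x ^ 2) ≤ 3 / 5 := by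
        rw [hc0, div_le_iff₀ (by positivity)]
        linarith
      linarith
    have hcoef : c0 d ^ d * c1 d * cΦ / (2 * Real.pi) ^ ((d : ℝ) / 2) = 1 / 2 * cΦ := by
      rw [c0_pow_mul_c1 hlam]
      field_simp
    rw [hcoef]
    gcongr ?_ * cΦ * _ * _
    calc (1 / 2 : ℝ) ≤ 5 / 2 * (2 / 5) := by norm_num
      _ ≤ _ := mul_le_mul (five_halves_le_rpow hd) hquot (by norm_num) (by positivity)
  refine ⟨hfirst, fun Ω hΩ => ?_⟩
  obtain ⟨r, hr0, hr⟩ := hΩ.subset_closedBall_lt 0 0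
  -- Since `-τ ≤ 0`, the factor `(q² + c₀²)^{-τ}` is smallest at the largest possible separation, at
  -- most the diameter `2 * r` of a ball containing `Ω`.
  refine ⟨c0 d ^ d * c1 d * cΦ / (2 * Real.pi) ^ ((d : ℝ) / 2) *
    ((2 * r) ^ 2 + c0 d ^ 2) ^ (-τ), ?_, fun X hXΩ hX => ?_⟩
  · rw [c0_pow_mul_c1 hlam]
    positivity
  · obtain ⟨t, ht, hle⟩ := hfirst X hX
    refine ⟨t, ht, le_trans ?_ hle⟩
    have hq := sepDist_pos hX
    rw [c0_pow_mul_c1 hlam]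
    gcongr ?_ * _
    gcongr _ * ?_
    refine Real.rpow_le_rpow_of_nonpos (by positivity) ?_ (by linarith)
    gcongr
    exact sepDist_le_of_subset_closedBall hX (hXΩ.trans hr)

end
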